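/- For a real number $\alpha$ let $S_n(\alpha)=\sum_{j=1}^{n}(-1)^{\lfloor j\alpha\rfloor}$ for $n\ge 0$ (so $S_0(\alpha)=0$). An integer $r\ge 0$ is a record of $S_n(\alpha)$ if $S_m(\alpha)\neq S_r(\alpha)$ for all $0\le m<r$; in particular $0$ is a record. Let $\xi=[a_0;a_1,a_2,\dots]$ be a real irrational number, and let $p_n/q_n=[a_0;a_1,\dots,a_n]$ be its convergents, so that $q_0=1$, $q_1=a_1$. Call $\xi$ a BR-number if $q_{2n+1}$ is even for all $n\ge 0$. A $\xi$-Ostrowski representation of an integer $N\ge 0$ is a finite (possibly empty) sequence of integer digits $b_j\cdots b_1b_0$ (leading zeros are allowed, and digits beyond the word are taken to be $0$) with $N=\sum_{i=0}^{j} b_iq_i$ such that (a) $0\le b_0<a_1$; (b) $0\le b_i\le a_{i+1}$ for $i\ge1$; (c) for $i\ge 1$, if $b_i=a_{i+1}$ then $b_{i-1}=0$. A set $A$ of non-negative integers is $\xi$-Ostrowski automatic if there are an integer $B$ with $a_i\le B$ for all $i\ge 1$ and a deterministic finite automaton over the alphabet $\{0,1,\dots,B\}$, reading the most significant digit first, that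 accepts exactly those words that are $\xi$-Ostrowski representations of elements of $A$. **Corollary.** Let $\xi$ be a real quadratic irrational that is a BR-number. Then: 1. The set of records of $S_n(2\xi)$ is $\xi$-Ostrowski automatic. 2. The set of records of $S_n(2\xi)$ is infinite, and its increasing enumeration $t_0<t_1<t_2<\cdots$ satisfies a system of linear recurrences: there are integers $p\ge 1$ and $d\ge 0$ and integers $c_{r,k}$ and $e_r$ (for $0\le r<p$, $1\le k\le d$) such that $$t_{pm+r}=\sum_{k=1}^{d}c_{r,k}\,t_{pm+r-k}+e_r$$ for all $m\ge 0$ and $0\le r<p$ with $pm+r\ge d$. -/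

import Mathlib

namespace OstrowskiWalk

noncomputable section

/-- The deterministic random walk `S_n(α) = ∑_{j=1}^n (-1)^⌊j α⌋`. -/
def walk (α : ℝ) (n : ℕ) : ℤ :=
  ∑ j ∈ Finset.Icc 1 n, (((-1 : ℤˣ) ^ ⌊(j : ℝ) * α⌋ : ℤˣ) : ℤ)

/-- `r` is a record of the walk `S_n(α)`: its value is taken by none of the earlier
partial sums `S_0(α) = 0, …, S_{r-1}(α)`. In particular `0` is a record. -/
def IsRecord (α : ℝ) (r : ℕ) : Prop :=
  ∀ m < r, walk α m ≠ walk α r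

/-- `ξ` is a real quadratic irrational. -/
def IsQuadraticIrrational (ξ : ℝ) : Prop :=
  Irrational ξ ∧ ∃ a b c : ℤ, a ≠ 0 ∧ (a : ℝ) * ξ ^ 2 + (b : ℝ) * ξ + (c : ℝ) = 0

/-- `partQuot ξ i` is the partial quotient `a_{i+1}` of the regular continued fraction
`ξ = [a_0; a_1, a_2, …]`, as a natural number. -/
def partQuot (ξ : ℝ) (i : ℕ) : ℕ :=
  ⌊((GenContFract.of ξ).partDens.get? i).getD 0⌋₊

/-- `convDen ξ n` is the denominator `q_n` of the `n`-th convergent of the regular continued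
fraction of `ξ`, as a natural number (so `q_0 = 1` and `q_1 = a_1`). -/
def convDen (ξ : ℝ) (n : ℕ) : ℕ :=
  ⌊(GenContFract.of ξ).dens n⌋₊

/-- Every partial quotient of an irrational number exists and is the natural number
`partQuot ξ i`; no rounding takes place. -/
theorem partDens_get?_eq {ξ : ℝ} (hξ : Irrational ξ) (i : ℕ) :
    (GenContFract.of ξ).partDens.get? i = some (partQuot ξ i : ℝ) := by
  have hnt : ¬ (GenContFract.of ξ).TerminatedAt i := fun h => by
    obtain ⟨q, hq⟩ := (GenContFract.terminates_iff_rat ξ).1 ⟨i, h⟩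
    exact hξ ⟨q, hq.symm⟩
  rw [GenContFract.terminatedAt_iff_partDen_none] at hnt
  obtain ⟨b, hb⟩ := Option.ne_none_iff_exists'.1 hnt
  obtain ⟨z, rfl⟩ := GenContFract.exists_int_eq_of_partDen hb
  have h1 : (1 : ℝ) ≤ z := GenContFract.of_one_le_get?_partDen hb
  have hz : (0 : ℤ) ≤ z := by
    have : (0 : ℝ) ≤ z := by linarith
    exact_mod_cast this
  lift z to ℕ using hz
  rw [partQuot, hb]
  simp

/-- The partial quotients `a_1, a_2, …` of an irrational number are positive. -/
theorem one_le_partQuot {ξ : ℝ} (hξ : Irrational ξ) (i : ℕ) : 1 ≤ partQuot ξ i := by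
  have := GenContFract.of_one_le_get?_partDen (partDens_get?_eq hξ i)
  exact_mod_cast this

/-- The recursion `q_{n+2} = a_{n+2} q_{n+1} + q_n` with its initial values, in `ℝ`. -/
theorem dens_recursion {ξ : ℝ} (hξ : Irrational ξ) :
    (GenContFract.of ξ).dens 0 = 1 ∧ (GenContFract.of ξ).dens 1 = (partQuot ξ 0 : ℝ) ∧
      ∀ n, (GenContFract.of ξ).dens (n + 2) = (partQuot ξ (n + 1) : ℝ) *
        (GenContFract.of ξ).dens (n + 1) + (GenContFract.of ξ).dens n := by
  have hs : ∀ i, (GenContFract.of ξ).s.get? i = some ⟨1, (partQuot ξ i : ℝ)⟩ := fun i => by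
    obtain ⟨gp, hgp, hb⟩ := GenContFract.exists_s_b_of_partDen (partDens_get?_eq hξ i)
    have ha := GenContFract.of_partNum_eq_one (GenContFract.partNum_eq_s_a hgp)
    rw [hgp, ← hb, ← ha]
  refine ⟨GenContFract.zeroth_den_eq_one, GenContFract.first_den_eq (hs 0), fun n => ?_⟩
  simpa using GenContFract.dens_recurrence (hs (n + 1)) rfl rfl

/-- The convergent denominators of an irrational number are the natural numbers `convDen ξ n`;
no rounding takes place. -/
theorem dens_eq {ξ : ℝ} (hξ : Irrational ξ) (n : ℕ) :
    (GenContFract.of ξ).dens n = (convDen ξ n : ℝ) := by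
  obtain ⟨h0, h1, hrec⟩ := dens_recursion hξ
  have key : ∃ k : ℕ, (GenContFract.of ξ).dens n = k := by
    induction n using Nat.twoStepInduction with
    | zero => exact ⟨1, by simp [h0]⟩
    | one => exact ⟨_, h1⟩
    | more m ih1 ih2 =>
      obtain ⟨a, ha⟩ := ih1
      obtain ⟨b, hb⟩ := ih2
      refine ⟨partQuot ξ (m + 1) * b + a, ?_⟩
      rw [hrec, ha, hb]
      push_cast
      ring
  obtain ⟨k, hk⟩ := key
  simp [convDen, hk]

/-- `q_0 = 1`, `q_1 = a_1` and `q_{n+2} = a_{n+2} q_{n+1} + q_n`. -/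
theorem convDen_recursion {ξ : ℝ} (hξ : Irrational ξ) :
    convDen ξ 0 = 1 ∧ convDen ξ 1 = partQuot ξ 0 ∧
      ∀ n, convDen ξ (n + 2) = partQuot ξ (n + 1) * convDen ξ (n + 1) + convDen ξ n := by
  have h := dens_recursion hξ
  simp only [dens_eq hξ] at h
  exact_mod_cast h

/-- `ξ` is a BR-number (after Boshernitzan and Ralston): all the convergent denominators
`q_{2n+1}` with odd index are even. -/
def IsBRNumber (ξ : ℝ) : Prop :=
  ∀ n : ℕ, Even (convDen ξ (2 * n + 1))

/-- `b` is an admissible sequence of Ostrowski digits with respect to `ξ`, where `b i` is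
the coefficient of `q_i`:
(a) `b_0 < a_1`; (b) `b_i ≤ a_{i+1}` for `i ≥ 1`;
(c) for `i ≥ 1`, if `b_i = a_{i+1}` then `b_{i-1} = 0`. -/
structure IsOstrowski (ξ : ℝ) (b : ℕ → ℕ) : Prop where
  zero_lt : b 0 < partQuot ξ 0
  le : ∀ i, 1 ≤ i → b i ≤ partQuot ξ i
  eq_zero : ∀ i, 1 ≤ i → b i = partQuot ξ i → b (i - 1) = 0

/-- A word over the alphabet `{0, …, B}` is read with its most significant digit first;
`digit w i` is its digit of weight `q_i` (and `0` beyond the length of the word). -/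
def digit {B : ℕ} (w : List (Fin (B + 1))) (i : ℕ) : ℕ :=
  (w.reverse.getD i 0 : Fin (B + 1))

/-- The value `∑ b_i q_i` of a word with digits `b_i`. -/
def wordValue (ξ : ℝ) {B : ℕ} (w : List (Fin (B + 1))) : ℕ :=
  ∑ i ∈ Finset.range w.length, digit w i * convDen ξ i

/-- The words over `{0, …, B}` that are `ξ`-Ostrowski representations (leading zeros are
allowed) of the elements of `A`. -/
def representations (ξ : ℝ) (B : ℕ) (A : Set ℕ) : Language (Fin (B + 1)) :=
  {w | IsOstrowski ξ (digit w) ∧ wordValue ξ w ∈ A}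

/-- `A` is `ξ`-Ostrowski automatic: over some finite digit alphabet that suffices for all
`ξ`-Ostrowski representations, a deterministic finite automaton accepts exactly the
representations of the elements of `A`. -/
def IsOstrowskiAutomatic (ξ : ℝ) (A : Set ℕ) : Prop :=
  ∃ B : ℕ, (∀ i, partQuot ξ i ≤ B) ∧ (representations ξ B A).IsRegular

/-- The integer sequence `t` satisfies a system of linear recurrences: for some period `p ≥ 1`
and order `d` there is, for each residue `r` mod `p`, one linear recurrence with constant
integer coefficients
`t_{pm+r} = c_{r,0} t_{pm+r-1} + ⋯ + c_{r,d-1} t_{pm+r-d} + e_r`,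
valid whenever `pm + r ≥ d` (the terms `t_0, …, t_{d-1}` are the initial values). -/
def SatisfiesLinearRecurrenceSystem (t : ℕ → ℤ) : Prop :=
  ∃ (p d : ℕ) (c : Fin p → Fin d → ℤ) (e : Fin p → ℤ), 1 ≤ p ∧
    ∀ (m : ℕ) (r : Fin p), d ≤ p * m + r →
      t (p * m + r) = ∑ k : Fin d, c r k * t (p * m + r - (k + 1)) + e r

end

end OstrowskiWalk

namespace OstrowskiWalk

noncomputable section

/-! ### Complete quotients, convergents and approximation errors -/

/-! Write W(m) for the walk S_m(2ξ). Replacing j by j + b q_{k+1} moves 2jξ, up to an even integer,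
only by 2b(q_{k+1}ξ - p_{k+1}), so a step of W can change only if an integer is crossed. Expressing
the crossed lattice point in the basis of two consecutive convergents (`eq_of_separates`) leaves one
candidate: 2j = q_k with 2b > a_{k+2}. For a BR-number q_k is even exactly for odd k. Hence blocks
of length q_{2n+1} repeat unchanged up to q_{2n+2}, while blocks of length q_{2n+2} repeat up to
q_{2n+3} with one ascending step reversed in each block of the second half.

Consequently W vanishes at q_{2n+1}, equals 1 at q_{2n}, stays nonnegative, and within q_{2n+1}
steps climbs to a new maximum and returns; `WalkBlock` carries this through the induction. Every
value v ≥ 0 is first reached at a time b q_{2n} + ∑_{i<n} (a_{2i+1}/2) q_{2i} with b ≤ a_{2n+1}/2,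
and all earlier values are smaller, so these times are the records (`isRecord_iff`).

Their Ostrowski digits are the truncations of the single sequence a_1/2, 0, a_3/2, 0, …, which is
eventually periodic by Lagrange's theorem; uniqueness of representations and Myhill–Nerode then give
the automaton. The gaps between records are the q_{2n}, each occurring a_{2n+1}/2 times. By
Cayley–Hamilton for the product of the continued fraction matrices over an even period, these
denominators satisfy an order-two recurrence from period to period, and this passes to the
increments of the records. -/

/-- The complete quotients `ξ_n = [a_n; a_{n+1}, …]` of `ξ`. -/
def completeQuot (ξ : ℝ) : ℕ → ℝ
  | 0 => ξ
  | n + 1 => (Int.fract (completeQuot ξ n))⁻¹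

theorem completeQuot_fract_inv (ξ : ℝ) (n : ℕ) :
    completeQuot (Int.fract ξ)⁻¹ n = completeQuot ξ (n + 1) := by
  induction n with
  | zero => rfl
  | succ n ih => rw [completeQuot, ih]; rfl

theorem _root_.Irrational.fract {x : ℝ} (hx : Irrational x) : Irrational (Int.fract x) := by
  rw [Int.fract]; exact hx.sub_intCast _

theorem irrational_completeQuot {ξ : ℝ} (hξ : Irrational ξ) (n : ℕ) :
    Irrational (completeQuot ξ n) := by
  induction n with
  | zero => exact hξ
  | succ n ih => exact ih.fract.inv

theorem fract_completeQuot_pos {ξ : ℝ} (hξ : Irrational ξ) (n : ℕ) :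
    0 < Int.fract (completeQuot ξ n) :=
  lt_of_le_of_ne (Int.fract_nonneg _) (irrational_completeQuot hξ n).fract.ne_zero.symm

theorem fract_mul_completeQuot_succ {ξ : ℝ} (hξ : Irrational ξ) (n : ℕ) :
    Int.fract (completeQuot ξ n) * completeQuot ξ (n + 1) = 1 :=
  mul_inv_cancel₀ (fract_completeQuot_pos hξ n).ne'

theorem one_lt_completeQuot_succ {ξ : ℝ} (hξ : Irrational ξ) (n : ℕ) :
    1 < completeQuot ξ (n + 1) :=
  (one_lt_inv₀ (fract_completeQuot_pos hξ n)).2 (Int.fract_lt_one _)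

theorem partQuot_eq_floor {ξ : ℝ} (hξ : Irrational ξ) (n : ℕ) :
    (partQuot ξ n : ℤ) = ⌊completeQuot ξ (n + 1)⌋ := by
  induction n generalizing ξ with
  | zero =>
    have h : (GenContFract.of ξ).s.get? 0 = some ⟨1, (⌊(Int.fract ξ)⁻¹⌋ : ℝ)⟩ :=
      GenContFract.of_s_head hξ.fract.ne_zero
    have h2 := partDens_get?_eq hξ 0
    rw [GenContFract.partDen_eq_s_b h] at h2
    have h3 := Option.some.inj h2
    simp only [completeQuot] at h3 ⊢
    exact_mod_cast h3.symm
  | succ n ih =>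
    have h : partQuot ξ (n + 1) = partQuot (Int.fract ξ)⁻¹ n := by
      have h1 := GenContFract.of_s_succ ξ n
      unfold partQuot
      simp only [GenContFract.partDens, Stream'.Seq.map_get?, h1]
    rw [h, ih hξ.fract.inv, completeQuot_fract_inv]

theorem completeQuot_succ_eq {ξ : ℝ} (hξ : Irrational ξ) (n : ℕ) :
    completeQuot ξ (n + 1) = partQuot ξ n + Int.fract (completeQuot ξ (n + 1)) := by
  have h : (partQuot ξ n : ℝ) = (⌊completeQuot ξ (n + 1)⌋ : ℝ) := by
    exact_mod_cast partQuot_eq_floor hξ n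
  rw [h, Int.floor_add_fract]

/-- The numerators of the convergents of `ξ`. -/
def convNum (ξ : ℝ) : ℕ → ℤ
  | 0 => ⌊ξ⌋
  | 1 => partQuot ξ 0 * ⌊ξ⌋ + 1
  | n + 2 => partQuot ξ (n + 1) * convNum ξ (n + 1) + convNum ξ n

/-- The approximation error `|q_n ξ - p_n|`. -/
def convErr (ξ : ℝ) (n : ℕ) : ℝ :=
  ∏ i ∈ Finset.range (n + 1), Int.fract (completeQuot ξ i)

theorem convErr_succ (ξ : ℝ) (n : ℕ) :
    convErr ξ (n + 1) = convErr ξ n * Int.fract (completeQuot ξ (n + 1)) :=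
  Finset.prod_range_succ _ _

theorem convErr_pos {ξ : ℝ} (hξ : Irrational ξ) (n : ℕ) : 0 < convErr ξ n :=
  Finset.prod_pos fun i _ => fract_completeQuot_pos hξ i

theorem convErr_lt_one {ξ : ℝ} (hξ : Irrational ξ) (n : ℕ) : convErr ξ n < 1 := by
  induction n with
  | zero => simpa [convErr] using Int.fract_lt_one _
  | succ n ih =>
    rw [convErr_succ]
    have := convErr_pos hξ n
    have h1 := Int.fract_lt_one (completeQuot ξ (n + 1))
    nlinarith

theorem convErr_succ_mul {ξ : ℝ} (hξ : Irrational ξ) (n : ℕ) :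
    convErr ξ (n + 1) * completeQuot ξ (n + 2) = convErr ξ n := by
  rw [convErr_succ, mul_assoc, fract_mul_completeQuot_succ hξ, mul_one]

theorem convErr_add_two {ξ : ℝ} (hξ : Irrational ξ) (n : ℕ) :
    convErr ξ (n + 2) = convErr ξ n - partQuot ξ (n + 1) * convErr ξ (n + 1) := by
  have h1 := convErr_succ_mul hξ n
  rw [completeQuot_succ_eq hξ (n + 1), mul_add] at h1
  rw [convErr_succ ξ (n + 1)]
  linarith

/-- The signed errors obey the recursion of the convergents, and the absolute errors the same one
with a minus sign; the factor (-1)^n reconciles the two. -/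
theorem convDen_mul_sub_convNum {ξ : ℝ} (hξ : Irrational ξ) (n : ℕ) :
    (convDen ξ n : ℝ) * ξ - convNum ξ n = (-1) ^ n * convErr ξ n := by
  obtain ⟨h0, h1, hrec⟩ := convDen_recursion hξ
  induction n using Nat.twoStepInduction with
  | zero => simp [h0, convNum, convErr, completeQuot, Int.self_sub_floor]
  | one =>
    have h2 := fract_mul_completeQuot_succ hξ 0
    rw [completeQuot_succ_eq hξ 0, mul_add] at h2
    simp only [completeQuot] at h2
    simp only [h1, convNum, convErr, completeQuot, Finset.prod_range_succ, Finset.prod_range_zero]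
    have h3 := Int.floor_add_fract ξ
    push_cast
    have h4 : (⌊ξ⌋ : ℝ) = ξ - Int.fract ξ := by linarith
    rw [h4]
    linear_combination h2
  | more n ih1 ih2 =>
    rw [hrec, convNum, convErr_add_two hξ]
    push_cast
    rw [pow_succ] at ih2
    rw [pow_succ, pow_succ]
    linear_combination ih1 + (partQuot ξ (n + 1) : ℝ) * ih2

theorem convDen_mul_convNum_sub {ξ : ℝ} (hξ : Irrational ξ) (n : ℕ) :
    (convDen ξ n : ℤ) * convNum ξ (n + 1) - convDen ξ (n + 1) * convNum ξ n = (-1) ^ n := by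
  obtain ⟨h0, h1, hrec⟩ := convDen_recursion hξ
  induction n with
  | zero => simp [h0, h1, convNum]
  | succ n ih =>
    rw [hrec, convNum, pow_succ]
    push_cast
    linear_combination -ih

theorem convDen_pos {ξ : ℝ} (hξ : Irrational ξ) (n : ℕ) : 0 < convDen ξ n := by
  obtain ⟨h0, h1, hrec⟩ := convDen_recursion hξ
  induction n using Nat.twoStepInduction with
  | zero => simp [h0]
  | one => rw [h1]; exact one_le_partQuot hξ 0
  | more n ih1 ih2 => rw [hrec]; positivity

theorem convDen_le_succ {ξ : ℝ} (hξ : Irrational ξ) (n : ℕ) :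
    convDen ξ n ≤ convDen ξ (n + 1) := by
  obtain ⟨h0, h1, hrec⟩ := convDen_recursion hξ
  cases n with
  | zero => rw [h0]; exact convDen_pos hξ 1
  | succ n =>
    rw [hrec]
    have := one_le_partQuot hξ (n + 1)
    nlinarith

theorem convDen_lt_add_two {ξ : ℝ} (hξ : Irrational ξ) (n : ℕ) :
    convDen ξ (n + 1) < convDen ξ (n + 2) := by
  obtain ⟨h0, h1, hrec⟩ := convDen_recursion hξ
  rw [hrec]
  have := one_le_partQuot hξ (n + 1)
  have := convDen_pos hξ n
  nlinarith

theorem le_convDen {ξ : ℝ} (hξ : Irrational ξ) (n : ℕ) : n ≤ convDen ξ n := by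
  induction n using Nat.twoStepInduction with
  | zero => simp
  | one => exact convDen_pos hξ 1
  | more n _ ih2 => exact ih2.trans_lt (convDen_lt_add_two hξ n)

theorem coprime_convDen {ξ : ℝ} (hξ : Irrational ξ) (n : ℕ) :
    Nat.Coprime (convDen ξ n) (convDen ξ (n + 1)) := by
  obtain ⟨h0, h1, hrec⟩ := convDen_recursion hξ
  induction n with
  | zero => simp [h0]
  | succ n ih => rw [hrec]; simpa using ih.symm

/-! ### Parity for BR-numbers -/

theorem IsBRNumber.odd_convDen {ξ : ℝ} (hBR : IsBRNumber ξ) (hξ : Irrational ξ) (n : ℕ) :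
    Odd (convDen ξ (2 * n)) := by
  rw [← Nat.not_even_iff_odd]
  intro h
  have h2 := Nat.dvd_gcd h.two_dvd (hBR n).two_dvd
  rw [coprime_convDen hξ (2 * n)] at h2
  omega

/-- In q_{2n+1} = a_{2n+1} q_{2n} + q_{2n-1} the outer denominators are even and q_{2n} is odd. -/
theorem IsBRNumber.even_partQuot {ξ : ℝ} (hBR : IsBRNumber ξ) (hξ : Irrational ξ) (n : ℕ) :
    Even (partQuot ξ (2 * n)) := by
  obtain ⟨h0, h1, hrec⟩ := convDen_recursion hξ
  cases n with
  | zero => simpa [h1] using hBR 0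
  | succ n =>
    have h2 := hBR (n + 1)
    have h3 : 2 * (n + 1) + 1 = (2 * n + 1) + 2 := by ring
    rw [h3, hrec] at h2
    have h4 := hBR.odd_convDen hξ (n + 1)
    have h5 := hBR n
    have h6 : 2 * (n + 1) = 2 * n + 1 + 1 := by ring
    rw [h6] at h4 ⊢
    rw [Nat.even_add, Nat.even_mul] at h2
    rw [← Nat.not_even_iff_odd] at h4
    tauto

theorem IsBRNumber.odd_add {ξ : ℝ} (hBR : IsBRNumber ξ) (hξ : Irrational ξ) (k : ℕ) :
    Odd (convDen ξ k + convDen ξ (k + 1)) := by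
  obtain ⟨n, rfl | rfl⟩ := Nat.even_or_odd' k
  · exact (hBR.odd_convDen hξ n).add_even (hBR n)
  · exact (hBR n).add_odd (hBR.odd_convDen hξ (n + 1))

theorem IsBRNumber.odd_convNum {ξ : ℝ} (hBR : IsBRNumber ξ) (hξ : Irrational ξ) (n : ℕ) :
    Odd (convNum ξ (2 * n + 1)) := by
  have h := convDen_mul_convNum_sub hξ (2 * n)
  have h2 : Even (convDen ξ (2 * n + 1) : ℤ) := by exact_mod_cast hBR n
  rw [← Int.not_even_iff_odd]
  intro h3
  have h4 : Even ((-1 : ℤ) ^ (2 * n)) := h ▸ (h3.mul_left _).sub (h2.mul_right _)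
  simp [pow_mul] at h4

/-! ### Single steps of the walk -/

/-- The `j`-th step of the walk `S_n(2ξ)`. -/
def step (ξ : ℝ) (j : ℕ) : ℤ := (((-1 : ℤˣ) ^ ⌊(j : ℝ) * (2 * ξ)⌋ : ℤˣ) : ℤ)

theorem walk_zero (α : ℝ) : walk α 0 = 0 := by simp [walk]

theorem walk_succ (ξ : ℝ) (n : ℕ) : walk (2 * ξ) (n + 1) = walk (2 * ξ) n + step ξ (n + 1) :=
  Finset.sum_Icc_succ_top (by omega) _

theorem step_eq_one {ξ : ℝ} {j : ℕ} (h : Even ⌊(j : ℝ) * (2 * ξ)⌋) : step ξ j = 1 := by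
  simp [step, h.neg_one_zpow]

theorem step_eq_neg_one {ξ : ℝ} {j : ℕ} (h : Odd ⌊(j : ℝ) * (2 * ξ)⌋) : step ξ j = -1 := by
  simp [step, h.neg_one_zpow]

theorem step_eq_step {ξ : ℝ} {i j : ℕ} {c : ℤ}
    (h : ⌊(i : ℝ) * (2 * ξ)⌋ = ⌊(j : ℝ) * (2 * ξ)⌋ + 2 * c) : step ξ i = step ξ j := by
  rcases Int.even_or_odd ⌊(j : ℝ) * (2 * ξ)⌋ with h1 | h1
  · rw [step_eq_one h1, step_eq_one (h ▸ h1.add (even_two_mul c))]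
  · rw [step_eq_neg_one h1, step_eq_neg_one (h ▸ h1.add_even (even_two_mul c))]

/-- An integer that separates `2jξ` from its translate by `2b(q_{k+1}ξ - p_{k+1})` is `p_k`, and
then `2j = q_k` and `2b > a_{k+2}`. -/
theorem eq_of_separates {ξ : ℝ} (hξ : Irrational ξ) (hBR : IsBRNumber ξ) {k j b : ℕ} {c : ℤ}
    (hj : 1 ≤ j) (hjq : j ≤ convDen ξ (k + 1))
    (hb : b * convDen ξ (k + 1) + j ≤ convDen ξ (k + 2))
    (h1 : (-1 : ℝ) ^ (k + 1) * (j * (2 * ξ) - c) < 0)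
    (h2 : 0 < (-1 : ℝ) ^ (k + 1) * (j * (2 * ξ) - c) + 2 * b * convErr ξ (k + 1)) :
    2 * j = convDen ξ k ∧ partQuot ξ (k + 1) < 2 * b := by
  obtain ⟨-, -, hrec⟩ := convDen_recursion hξ
  have hdet := convDen_mul_convNum_sub hξ k
  have e1 := convDen_mul_sub_convNum hξ k
  have e2 := convDen_mul_sub_convNum hξ (k + 1)
  have hu := convErr_pos hξ k
  have hv := convErr_pos hξ (k + 1)
  have hw := convErr_pos hξ (k + 2)
  rw [convErr_add_two hξ] at hw
  have hodd := hBR.odd_add hξ k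
  have hq' := convDen_pos hξ k
  have hqq := convDen_le_succ hξ k
  rw [hrec] at hb
  generalize convErr ξ k = u at *
  generalize convErr ξ (k + 1) = v at *
  generalize convDen ξ k = q' at *
  generalize convDen ξ (k + 1) = q at *
  generalize convNum ξ k = P' at *
  generalize convNum ξ (k + 1) = P at *
  generalize partQuot ξ (k + 1) = a at *
  obtain ⟨σ, hσ, hσ2⟩ : ∃ σ : ℤ, σ = (-1) ^ k ∧ σ * σ = 1 :=
    ⟨_, rfl, by rw [← pow_add]; simp [← two_mul, pow_mul]⟩
  have hσr : (-1 : ℝ) ^ k = σ := by rw [hσ]; push_cast; rfl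
  have hσr2 : (σ : ℝ) * σ = 1 := by exact_mod_cast hσ2
  rw [pow_succ, hσr] at h1 h2 e2
  rw [hσr] at e1
  rw [← hσ] at hdet
  -- Cramer's rule: x and y are the coordinates of (2j, c) in the unimodular basis (q_{k+1},
  -- p_{k+1}), (q_k, p_k).
  obtain ⟨x, hx⟩ : ∃ x : ℤ, x = σ * (c * q' - 2 * j * P') := ⟨_, rfl⟩
  obtain ⟨y, hy⟩ : ∃ y : ℤ, y = σ * (2 * j * P - c * q) := ⟨_, rfl⟩
  have hxy : (2 * j : ℤ) = x * q + y * q' := by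
    rw [hx, hy]
    linear_combination (-2 * (j : ℤ)) * hσ2 - 2 * j * σ * hdet
  have hc : c = x * P + y * P' := by
    rw [hx, hy]
    linear_combination (-c) * hσ2 - c * σ * hdet
  have hxyr : (2 * j : ℝ) = x * q + y * q' := by exact_mod_cast hxy
  have hcr : (c : ℝ) = x * P + y * P' := by exact_mod_cast hc
  have key : (σ : ℝ) * -1 * (j * (2 * ξ) - c) = x * v - y * u := by
    have : (j : ℝ) * (2 * ξ) - c = x * (σ * -1 * v) + y * (σ * u) := by
      rw [← e1, ← e2, hcr]; linear_combination ξ * hxyr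
    rw [this]
    linear_combination (x * v - y * u) * hσr2
  rw [key] at h1 h2
  have hy1 : 1 ≤ y := by
    by_contra! hy0
    have hy0 : y ≤ 0 := by omega
    have hy0r : (y : ℝ) ≤ 0 := by exact_mod_cast hy0
    have hx0r : (x : ℝ) < 0 := by
      by_contra! hx0
      nlinarith [mul_nonneg hx0 hv.le, mul_nonneg (neg_nonneg.2 hy0r) hu.le]
    have hx0 : x < 0 := by exact_mod_cast hx0r
    have e3 : x * q ≤ 0 := mul_nonpos_of_nonpos_of_nonneg hx0.le (by positivity)
    have e4 : y * q' ≤ 0 := mul_nonpos_of_nonpos_of_nonneg hy0 (by positivity)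
    omega
  -- The separation gives y u < (x + 2b) v, and a v < u because the next error u - a v is positive.
  have hya : y * a < x + 2 * b := by
    have hy1r : (1 : ℝ) ≤ y := by exact_mod_cast hy1
    have e3 : (y : ℝ) * (a * v) < (x + 2 * b) * v := by
      have : (y : ℝ) * (a * v) < y * u := by
        apply mul_lt_mul_of_pos_left _ (by linarith); linarith
      linarith
    have e4 : (y : ℝ) * a < x + 2 * b := by
      rw [← mul_assoc] at e3
      exact lt_of_mul_lt_mul_right e3 hv.le
    exact_mod_cast e4
  have hbz : (b : ℤ) * q + j ≤ a * q + q' := by exact_mod_cast hb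
  have hqpos : (0 : ℤ) < q := by omega
  have hq'pos : (0 : ℤ) < q' := by omega
  have hqqz : (q' : ℤ) ≤ q := by omega
  -- Combined with 2(bq + j) ≤ 2q_{k+2}, this size bound rules out y ≥ 2.
  have e5 : y * (a * q + q') + q ≤ 2 * (a * q + q') := by
    have : (y * a + 1) * q ≤ (x + 2 * b) * q := mul_le_mul_of_nonneg_right hya hqpos.le
    linarith
  have hpos : (0 : ℤ) < a * q + q' := by positivity
  obtain rfl : y = 1 := by
    have : y < 2 := by
      by_contra! h
      nlinarith
    omega
  have hx0 : 0 ≤ x := by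
    by_contra! h
    nlinarith
  have hx1 : x ≤ 1 := by
    by_contra! h
    have : (j : ℤ) ≤ q := by exact_mod_cast hjq
    nlinarith
  obtain rfl | rfl : x = 0 ∨ x = 1 := by omega
  · constructor
    · have : (2 * j : ℤ) = q' := by linarith
      exact_mod_cast this
    · have : (a : ℤ) < 2 * b := by linarith
      exact_mod_cast this
  -- Here 2j = q_k + q_{k+1}, which is odd for a BR-number.
  · exfalso
    have : (2 * j : ℤ) = q' + q := by linarith
    have h3 : 2 * j = q' + q := by exact_mod_cast this
    rw [← h3] at hodd
    exact (Nat.not_odd_iff_even.2 (even_two_mul j)) hodd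

theorem mul_two_mul_ne_int {ξ : ℝ} (hξ : Irrational ξ) {j : ℕ} (hj : 1 ≤ j) (c : ℤ) :
    (j : ℝ) * (2 * ξ) ≠ c := by
  have h : Irrational ((2 * j : ℕ) * ξ) := hξ.natCast_mul (by omega)
  have := h.ne_int c
  push_cast at this
  intro h2
  apply this
  rw [← h2]; ring

theorem translate_eq {ξ : ℝ} (hξ : Irrational ξ) (k j b : ℕ) :
    ((b * convDen ξ (k + 1) + j : ℕ) : ℝ) * (2 * ξ) =
      j * (2 * ξ) + (-1) ^ (k + 1) * (2 * b * convErr ξ (k + 1)) +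
        ((2 * (b * convNum ξ (k + 1)) : ℤ) : ℝ) := by
  have e2 := convDen_mul_sub_convNum hξ (k + 1)
  push_cast
  linear_combination (2 * b : ℝ) * e2

/-- The steps of the walk repeat with period `q_{k+1}` up to time `q_{k+2}`, except at
the time `q_k / 2` of the second half of the periods. -/
theorem step_translate {ξ : ℝ} (hξ : Irrational ξ) (hBR : IsBRNumber ξ) {k j b : ℕ}
    (hj : 1 ≤ j) (hjq : j ≤ convDen ξ (k + 1))
    (hb : b * convDen ξ (k + 1) + j ≤ convDen ξ (k + 2))
    (hne : ¬ (2 * j = convDen ξ k ∧ partQuot ξ (k + 1) < 2 * b)) :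
    step ξ (b * convDen ξ (k + 1) + j) = step ξ j := by
  apply step_eq_step (c := b * convNum ξ (k + 1))
  rw [translate_eq hξ, Int.floor_add_intCast]
  congr 1
  have hv : 0 ≤ 2 * b * convErr ξ (k + 1) := by have := convErr_pos hξ (k + 1); positivity
  have hsep : ∀ c : ℤ, _ → _ → False := fun c h1 h2 =>
    hne (eq_of_separates hξ hBR (c := c) hj hjq hb h1 h2)
  have hni : ∀ c : ℤ, (j : ℝ) * (2 * ξ) + (-1) ^ (k + 1) * (2 * b * convErr ξ (k + 1)) ≠ c := by
    intro c hc
    apply mul_two_mul_ne_int hξ (j := b * convDen ξ (k + 1) + j) (by omega)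
      (c + 2 * (b * convNum ξ (k + 1)))
    rw [translate_eq hξ, hc]; push_cast; ring
  have hnj := mul_two_mul_ne_int hξ hj
  generalize (j : ℝ) * (2 * ξ) = z at *
  generalize 2 * b * convErr ξ (k + 1) = w at *
  -- The translate lies to the right of `z` for even k + 1 and to the left for odd k + 1. If the
  -- floors differ, the floor of the right-hand point separates the two.
  rcases Nat.even_or_odd (k + 1) with hk | hk
  · simp only [hk.neg_one_pow, one_mul] at *
    refine le_antisymm ?_ (Int.floor_le_floor (by linarith))
    by_contra! h
    have h1 : z < ⌊z + w⌋ := Int.floor_lt.1 h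
    have h2 := (Int.floor_le (z + w)).lt_of_ne (hni _).symm
    exact hsep ⌊z + w⌋ (by linarith) (by linarith)
  · simp only [hk.neg_one_pow, neg_one_mul] at *
    refine le_antisymm (Int.floor_le_floor (by linarith)) ?_
    by_contra! h
    have h1 : z + -w < ⌊z⌋ := Int.floor_lt.1 h
    have h2 := (Int.floor_le z).lt_of_ne (hnj _).symm
    exact hsep ⌊z⌋ (by linarith) (by linarith)

/-- Here 2jξ lies just below the odd integer p_{2n+1}, by the error u of index 2n+1. With v the next
error, u < (a_{2n+3} + 1)v ≤ 2bv, so the translation by 2bv crosses p_{2n+1} and flips the parity.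
-/
theorem step_half {ξ : ℝ} (hξ : Irrational ξ) (hBR : IsBRNumber ξ) {n j b : ℕ}
    (hj : 2 * j = convDen ξ (2 * n + 1)) (hb : b ≤ partQuot ξ (2 * n + 2))
    (hb2 : partQuot ξ (2 * n + 2) < 2 * b) :
    step ξ j = 1 ∧ step ξ (b * convDen ξ (2 * n + 2) + j) = -1 := by
  have hP := hBR.odd_convNum hξ n
  have e1 := convDen_mul_sub_convNum hξ (2 * n + 1)
  have hu1 := convErr_lt_one hξ (2 * n + 1)
  have hu := convErr_pos hξ (2 * n + 1)
  have hv := convErr_pos hξ (2 * n + 2)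
  have hw := convErr_pos hξ (2 * n + 3)
  rw [convErr_add_two hξ] at hw
  have hw2 : convErr ξ (2 * n + 3) < convErr ξ (2 * n + 2) := by
    rw [convErr_succ]
    exact mul_lt_of_lt_one_right hv (Int.fract_lt_one _)
  rw [convErr_add_two hξ] at hw2
  have hodd : Odd (2 * n + 1) := odd_two_mul_add_one n
  rw [hodd.neg_one_pow] at e1
  have hjr : (2 * j : ℝ) = convDen ξ (2 * n + 1) := by exact_mod_cast hj
  have hjx : (j : ℝ) * (2 * ξ) = convNum ξ (2 * n + 1) - convErr ξ (2 * n + 1) := by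
    linear_combination e1 + ξ * hjr
  have hbr : (b : ℝ) ≤ partQuot ξ (2 * n + 2) := by exact_mod_cast hb
  have hb2r : (partQuot ξ (2 * n + 2) : ℝ) + 1 ≤ 2 * b := by exact_mod_cast hb2
  have hbv := mul_le_mul_of_nonneg_right hbr hv.le
  have hbv2 := mul_le_mul_of_nonneg_right hb2r hv.le
  constructor
  · apply step_eq_one
    have : ⌊(j : ℝ) * (2 * ξ)⌋ = convNum ξ (2 * n + 1) - 1 := by
      rw [Int.floor_eq_iff, hjx]
      push_cast
      constructor <;> linarith
    rw [this]
    exact hP.sub_odd odd_one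
  · apply step_eq_neg_one
    rw [translate_eq hξ (2 * n + 1) j b, Int.floor_add_intCast]
    have heven : Even (2 * n + 1 + 1) := hodd.add_one
    have : ⌊(j : ℝ) * (2 * ξ) + (-1) ^ (2 * n + 1 + 1) * (2 * b * convErr ξ (2 * n + 1 + 1))⌋
        = convNum ξ (2 * n + 1) := by
      rw [Int.floor_eq_iff, hjx, heven.neg_one_pow]
      simp only [show 2 * n + 1 + 1 = 2 * n + 2 from rfl] at *
      constructor <;> linarith
    rw [this]
    exact hP.add_even (even_two_mul _)

/-! ### The walk along blocks of length `q_k` -/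

/-- Half of the partial quotient `a_{i+1}` for even `i`, and `0` for odd `i`. -/
def halfQuot (ξ : ℝ) (i : ℕ) : ℕ := if Even i then partQuot ξ i / 2 else 0

/-- The number with the Ostrowski digits `halfQuot ξ i`, `i < n`. -/
def peakPos (ξ : ℝ) (n : ℕ) : ℕ := ∑ i ∈ Finset.range n, halfQuot ξ i * convDen ξ i

/-- The value of the walk at the time `peakPos ξ n`. -/
def peakVal (ξ : ℝ) (n : ℕ) : ℕ := ∑ i ∈ Finset.range n, halfQuot ξ i

theorem halfQuot_odd (ξ : ℝ) (n : ℕ) : halfQuot ξ (2 * n + 1) = 0 := by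
  simp [halfQuot]

theorem IsBRNumber.two_mul_halfQuot {ξ : ℝ} (hBR : IsBRNumber ξ) (hξ : Irrational ξ) (n : ℕ) :
    2 * halfQuot ξ (2 * n) = partQuot ξ (2 * n) := by
  simp only [halfQuot, even_two_mul, if_true]
  exact Nat.two_mul_div_two_of_even (hBR.even_partQuot hξ n)

theorem peakPos_succ (ξ : ℝ) (n : ℕ) :
    peakPos ξ (n + 1) = halfQuot ξ n * convDen ξ n + peakPos ξ n := by
  rw [peakPos, Finset.sum_range_succ, add_comm]; rfl

theorem peakVal_succ (ξ : ℝ) (n : ℕ) : peakVal ξ (n + 1) = halfQuot ξ n + peakVal ξ n := by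
  rw [peakVal, Finset.sum_range_succ, add_comm]; rfl

theorem peakPos_add_two (ξ : ℝ) (n : ℕ) : peakPos ξ (2 * n + 2) = peakPos ξ (2 * n + 1) := by
  rw [peakPos_succ, halfQuot_odd]; simp

theorem peakVal_add_two (ξ : ℝ) (n : ℕ) : peakVal ξ (2 * n + 2) = peakVal ξ (2 * n + 1) := by
  rw [peakVal_succ, halfQuot_odd]; simp

/-- This identifies the peak time with q_{2n+1}/2, the time of the step that is reversed in later
blocks: the reversed step is the one that would reach the maximum. -/
theorem IsBRNumber.two_mul_peakPos {ξ : ℝ} (hBR : IsBRNumber ξ) (hξ : Irrational ξ) (n : ℕ) :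
    2 * peakPos ξ (2 * n + 1) = convDen ξ (2 * n + 1) := by
  obtain ⟨h0, h1, hrec⟩ := convDen_recursion hξ
  induction n with
  | zero =>
    have := hBR.two_mul_halfQuot hξ 0
    rw [peakPos_succ]
    simp only [mul_zero] at this
    simp [peakPos, h0, h1, this]
  | succ n ih =>
    have := hBR.two_mul_halfQuot hξ (n + 1)
    rw [peakPos_succ, show 2 * (n + 1) = 2 * n + 2 by ring] at *
    rw [show 2 * n + 2 + 1 = 2 * n + 1 + 2 by ring, hrec (2 * n + 1), peakPos_add_two, peakPos_succ,
      ← this]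
    linarith

/-- Each alternative in `hne` avoids the exceptional step: q_k is not of the form 2j, or the block
lies in the first half, or the segment stops before q_k/2. -/
theorem walk_mul_add {ξ : ℝ} (hξ : Irrational ξ) (hBR : IsBRNumber ξ) {k b m : ℕ}
    (hm : m ≤ convDen ξ (k + 1)) (hb : b * convDen ξ (k + 1) + m ≤ convDen ξ (k + 2))
    (hne : Odd (convDen ξ k) ∨ 2 * b ≤ partQuot ξ (k + 1) ∨ 2 * m < convDen ξ k) :
    walk (2 * ξ) (b * convDen ξ (k + 1) + m) =
      walk (2 * ξ) (b * convDen ξ (k + 1)) + walk (2 * ξ) m := by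
  induction m with
  | zero => simp [walk_zero]
  | succ m ih =>
    have hstep : step ξ (b * convDen ξ (k + 1) + (m + 1)) = step ξ (m + 1) := by
      apply step_translate hξ hBR (by omega) hm hb
      rintro ⟨h1, h2⟩
      rcases hne with h | h | h
      · rw [← h1] at h
        exact (Nat.not_odd_iff_even.2 (even_two_mul _)) h
      · omega
      · omega
    rw [← add_assoc, walk_succ, walk_succ, ih (by omega) (by omega) (hne.imp_right (Or.imp_right (by omega))), add_assoc _ m 1,
      hstep, add_assoc]

/-- In the second half of the periods of even index, one step of the walk is reversed. -/
theorem walk_mul_add_of_half {ξ : ℝ} (hξ : Irrational ξ) (hBR : IsBRNumber ξ) {n b m : ℕ}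
    (hm : m ≤ convDen ξ (2 * n + 2)) (hmb : b * convDen ξ (2 * n + 2) + m ≤ convDen ξ (2 * n + 3))
    (hb : b ≤ partQuot ξ (2 * n + 2)) (hb2 : partQuot ξ (2 * n + 2) < 2 * b)
    (hmq : convDen ξ (2 * n + 1) ≤ 2 * m) :
    walk (2 * ξ) (b * convDen ξ (2 * n + 2) + m) =
      walk (2 * ξ) (b * convDen ξ (2 * n + 2)) + walk (2 * ξ) m - 2 := by
  induction m with
  | zero => have := convDen_pos hξ (2 * n + 1); omega
  | succ m ih =>
    rw [← add_assoc, walk_succ, walk_succ, add_assoc _ m 1]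
    by_cases h : 2 * (m + 1) = convDen ξ (2 * n + 1)
    · obtain ⟨h1, h2⟩ := step_half hξ hBR h hb hb2
      rw [walk_mul_add (k := 2 * n + 1) hξ hBR (m.le_succ.trans hm)
        (le_trans (by simp only [Nat.reduceAdd, add_assoc]; omega) hmb)
        (Or.inr (Or.inr (by omega))), h1, h2]
      ring
    · have heven := hBR n
      rw [ih (by omega) (by omega) (by grind), step_translate hξ hBR (by omega) hm hmb (by tauto)]
      ring

theorem walk_odd_mul_add {ξ : ℝ} (hξ : Irrational ξ) (hBR : IsBRNumber ξ) {n : ℕ}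
    (hw : walk (2 * ξ) (convDen ξ (2 * n + 1)) = 0) {b m : ℕ} (hm : m ≤ convDen ξ (2 * n + 1))
    (hb : b * convDen ξ (2 * n + 1) + m ≤ convDen ξ (2 * n + 2)) :
    walk (2 * ξ) (b * convDen ξ (2 * n + 1) + m) = walk (2 * ξ) m := by
  have hodd := hBR.odd_convDen hξ n
  have : walk (2 * ξ) (b * convDen ξ (2 * n + 1)) = 0 := by
    induction b generalizing m with
    | zero => simp [walk_zero]
    | succ b ih =>
      rw [add_mul, one_mul] at hb ⊢
      rw [walk_mul_add hξ hBR le_rfl (by omega) (Or.inl hodd), hw, ih (Nat.zero_le _) (by omega),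
        add_zero]
  rw [walk_mul_add hξ hBR hm hb (Or.inl hodd), this, zero_add]

/-- Block number b contains the reversed step only if 2b > a_{2n+3}. So the blocks 0, …, a_{2n+3}/2
contribute 1 each and the later ones 1 - 2 = -1, which puts the turning point at a_{2n+3}/2 + 1. -/
theorem walk_even_mul {ξ : ℝ} (hξ : Irrational ξ) (hBR : IsBRNumber ξ) {n : ℕ}
    (hw : walk (2 * ξ) (convDen ξ (2 * n + 2)) = 1) {b : ℕ} (hb : b ≤ partQuot ξ (2 * n + 2)) :
    walk (2 * ξ) (b * convDen ξ (2 * n + 2)) =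
      if b ≤ halfQuot ξ (2 * n + 2) + 1 then (b : ℤ) else partQuot ξ (2 * n + 2) + 2 - b := by
  obtain ⟨-, -, hrec⟩ := convDen_recursion hξ
  have hhalf := hBR.two_mul_halfQuot hξ (n + 1)
  rw [show 2 * (n + 1) = 2 * n + 2 by ring] at hhalf
  induction b with
  | zero => simp [walk_zero]
  | succ b ih =>
    have h1 : (b + 1) * convDen ξ (2 * n + 2) ≤ convDen ξ (2 * n + 3) := by
      have := hrec (2 * n + 1)
      exact this ▸ (Nat.mul_le_mul_right _ hb).trans (Nat.le_add_right _ _)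
    rw [add_mul, one_mul] at h1 ⊢
    by_cases h : 2 * b ≤ partQuot ξ (2 * n + 2)
    · rw [walk_mul_add hξ hBR le_rfl h1 (Or.inr (Or.inl h)), ih (by omega), hw, if_pos (by omega),
        if_pos (by omega)]
      push_cast; ring
    · have h2 := (convDen_lt_add_two hξ (2 * n)).le
      rw [walk_mul_add_of_half hξ hBR le_rfl h1 (by omega) (by omega) (by omega), ih (by omega), hw]
      split_ifs <;> push_cast <;> omega

/-- The behaviour of the walk on the first `q_{2n+1}` steps. -/
structure WalkBlock (ξ : ℝ) (n : ℕ) : Prop where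
  nonneg : ∀ m ≤ convDen ξ (2 * n + 1), 0 ≤ walk (2 * ξ) m
  le : ∀ m ≤ convDen ξ (2 * n + 1), walk (2 * ξ) m ≤ peakVal ξ (2 * n + 1)
  walk_odd : walk (2 * ξ) (convDen ξ (2 * n + 1)) = 0
  walk_even : walk (2 * ξ) (convDen ξ (2 * n)) = 1
  walk_eq : ∀ b ≤ halfQuot ξ (2 * n),
    walk (2 * ξ) (b * convDen ξ (2 * n) + peakPos ξ (2 * n)) = b + peakVal ξ (2 * n)
  walk_lt : ∀ b ≤ halfQuot ξ (2 * n), ∀ m < b * convDen ξ (2 * n) + peakPos ξ (2 * n),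
    walk (2 * ξ) m < b + peakVal ξ (2 * n)

/-- Before the time `q_1` the walk goes up to `a_1 / 2` and back. -/
theorem walk_of_le_convDen_one {ξ : ℝ} (hξ : Irrational ξ) (hBR : IsBRNumber ξ) {m : ℕ}
    (hm : m ≤ convDen ξ 1) :
    walk (2 * ξ) m = if m ≤ halfQuot ξ 0 then (m : ℤ) else convDen ξ 1 - m := by
  obtain ⟨h0, h1, -⟩ := convDen_recursion hξ
  have hhalf := hBR.two_mul_halfQuot hξ 0
  rw [mul_zero, ← h1] at hhalf
  have e0 := convDen_mul_sub_convNum hξ 0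
  have e1 := convDen_mul_sub_convNum hξ 1
  have hu := convErr_pos hξ 0
  have hv := convErr_pos hξ 1
  have hu1 := convErr_lt_one hξ 0
  have hvu : convErr ξ 1 < convErr ξ 0 := by
    rw [convErr_succ]
    exact mul_lt_of_lt_one_right hu (Int.fract_lt_one _)
  simp only [h0, convNum, ← h1] at e0 e1
  push_cast at e0 e1
  -- Modulo even integers 2mξ is 2m times the error of index 0, and this identity shows that it
  -- passes 1 just after m = q_1/2 and stays below 2 up to m = q_1.
  have e2 : (convDen ξ 1 : ℝ) * convErr ξ 0 = 1 - convErr ξ 1 := by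
    linear_combination e1 - (convDen ξ 1 : ℝ) * e0
  induction m with
  | zero => simp [walk_zero]
  | succ m ih =>
    have key : ((m + 1 : ℕ) : ℝ) * (2 * ξ) =
        2 * (m + 1 : ℕ) * convErr ξ 0 + ((2 * ((m + 1 : ℕ) * ⌊ξ⌋) : ℤ) : ℝ) := by
      push_cast; linear_combination (2 * ((m : ℝ) + 1)) * e0
    rw [walk_succ, ih (by omega)]
    by_cases h : m + 1 ≤ halfQuot ξ 0
    · have hs : step ξ (m + 1) = 1 := by
        apply step_eq_one
        rw [key, Int.floor_add_intCast]
        have : ⌊2 * (m + 1 : ℕ) * convErr ξ 0⌋ = 0 := by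
          rw [Int.floor_eq_zero_iff]
          refine ⟨by positivity, ?_⟩
          have : (2 * (m + 1 : ℕ) : ℝ) ≤ convDen ξ 1 := by rw [← hhalf]; exact_mod_cast (by omega)
          have := mul_le_mul_of_nonneg_right this hu.le
          linarith
        rw [this]; simp
      rw [hs, if_pos (by omega), if_pos h]; push_cast; ring
    · have hs : step ξ (m + 1) = -1 := by
        apply step_eq_neg_one
        rw [key, Int.floor_add_intCast]
        have : ⌊2 * (m + 1 : ℕ) * convErr ξ 0⌋ = 1 := by
          rw [Int.floor_eq_iff]
          have a1 : (convDen ξ 1 : ℝ) + 2 ≤ 2 * (m + 1 : ℕ) := by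
            rw [← hhalf]; exact_mod_cast (by omega)
          have a2 : ((m + 1 : ℕ) : ℝ) ≤ convDen ξ 1 := by exact_mod_cast hm
          have a3 := mul_le_mul_of_nonneg_right a1 hu.le
          have a4 := mul_le_mul_of_nonneg_right a2 hu.le
          push_cast at a3 a4 ⊢
          constructor <;> linarith
        rw [this]
        exact odd_one.add_even (even_two_mul _)
      rw [hs, if_neg h]; split_ifs <;> push_cast <;> omega

theorem walkBlock_zero {ξ : ℝ} (hξ : Irrational ξ) (hBR : IsBRNumber ξ) : WalkBlock ξ 0 := by
  obtain ⟨h0, h1, -⟩ := convDen_recursion hξ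
  have hhalf := hBR.two_mul_halfQuot hξ 0
  have ha := one_le_partQuot hξ 0
  rw [mul_zero, ← h1] at hhalf
  have hw := fun m (hm : m ≤ convDen ξ 1) => walk_of_le_convDen_one hξ hBR hm
  have hp0 : peakPos ξ 0 = 0 := rfl
  have hv0 : peakVal ξ 0 = 0 := rfl
  constructor <;> simp only [mul_zero, zero_add, peakVal_succ, h0, hp0, hv0, mul_one, add_zero]
  · intro m hm; rw [hw m hm]; split_ifs <;> omega
  · intro m hm; rw [hw m hm]; split_ifs <;> omega
  · rw [hw _ le_rfl]; split_ifs <;> omega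
  · rw [hw _ (by omega), if_pos (by omega)]; rfl
  · intro b hb; rw [hw _ (by omega), if_pos hb]; simp
  · intro b hb m hm; rw [hw _ (by omega), if_pos (by omega)]; simpa using hm

/-- The first q_{2n+2} steps are a_{2n+2} copies of the q_{2n+1}-block, each of sum 0, and a segment
of length q_{2n} and sum 1. The first q_{2n+3} steps are then a_{2n+3} copies of this
q_{2n+2}-block, rising in the first half and with the reversed step in the second, and a segment of
length q_{2n+1}. -/
theorem WalkBlock.succ {ξ : ℝ} (hξ : Irrational ξ) (hBR : IsBRNumber ξ) {n : ℕ}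
    (h : WalkBlock ξ n) : WalkBlock ξ (n + 1) := by
  obtain ⟨-, -, hrec⟩ := convDen_recursion hξ
  have hhalf := hBR.two_mul_halfQuot hξ (n + 1)
  have hpk := hBR.two_mul_peakPos hξ n
  have hpk2 := hBR.two_mul_peakPos hξ (n + 1)
  have hval := peakVal_succ ξ (2 * (n + 1))
  have hq3 := hrec (2 * n + 1)
  have hlt := convDen_lt_add_two hξ (2 * n)
  have hq1 := convDen_pos hξ (2 * n + 1)
  have hdm : ∀ m q : ℕ, m / q * q + m % q = m := fun m q => Nat.div_add_mod' m q
  have ha1 := one_le_partQuot hξ (2 * n + 2)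
  rw [peakPos_succ] at hpk2
  simp only [show 2 * (n + 1) = 2 * n + 2 by ring, show 2 * n + 2 + 1 = 2 * n + 3 from rfl,
    show 2 * n + 1 + 1 = 2 * n + 2 from rfl] at *
  -- the walk on the first `q_{2n+2}` steps
  have hbd : ∀ m ≤ convDen ξ (2 * n + 2),
      0 ≤ walk (2 * ξ) m ∧ walk (2 * ξ) m ≤ peakVal ξ (2 * n + 2) := by
    intro m hm
    have hmod := (Nat.mod_lt m hq1).le
    have := walk_odd_mul_add hξ hBR h.walk_odd (b := m / convDen ξ (2 * n + 1)) hmod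
      (by rw [hdm]; exact hm)
    rw [hdm] at this
    rw [this, peakVal_add_two]
    exact ⟨h.nonneg _ hmod, h.le _ hmod⟩
  have hw1 : walk (2 * ξ) (convDen ξ (2 * n + 2)) = 1 := by
    have := walk_odd_mul_add hξ hBR h.walk_odd (b := partQuot ξ (2 * n + 1))
      (convDen_le_succ hξ (2 * n)) (by rw [hrec])
    rw [← hrec] at this
    rw [this, h.walk_even]
  have hpeak : walk (2 * ξ) (peakPos ξ (2 * n + 2)) = peakVal ξ (2 * n + 2) := by
    have := h.walk_eq _ le_rfl
    rw [peakPos_add_two, peakVal_add_two, peakPos_succ, peakVal_succ, this]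
    push_cast; ring
  have hless : ∀ m < peakPos ξ (2 * n + 2), walk (2 * ξ) m < peakVal ξ (2 * n + 2) := by
    intro m hm
    rw [peakPos_add_two, peakPos_succ] at hm
    have := h.walk_lt _ le_rfl m hm
    rw [peakVal_add_two, peakVal_succ]
    push_cast; exact this
  have hppos := peakPos_add_two ξ n
  -- the walk in the first half of the blocks of length `q_{2n+2}`
  have hfirst : ∀ b m, 2 * b ≤ partQuot ξ (2 * n + 2) → m ≤ convDen ξ (2 * n + 2) →
      b * convDen ξ (2 * n + 2) + m ≤ convDen ξ (2 * n + 3) →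
      walk (2 * ξ) (b * convDen ξ (2 * n + 2) + m) = b + walk (2 * ξ) m := by
    intro b m hb hm hbm
    rw [walk_mul_add hξ hBR hm hbm (Or.inr (Or.inl hb)), walk_even_mul hξ hBR hw1 (by omega),
      if_pos (by omega)]
  have hsecond : ∀ b m, partQuot ξ (2 * n + 2) < 2 * b → b ≤ partQuot ξ (2 * n + 2) →
      m ≤ convDen ξ (2 * n + 2) →
      b * convDen ξ (2 * n + 2) + m ≤ convDen ξ (2 * n + 3) →
      walk (2 * ξ) (b * convDen ξ (2 * n + 2) + m) = partQuot ξ (2 * n + 2) + 2 - b +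
        walk (2 * ξ) m - if m < peakPos ξ (2 * n + 2) then 0 else 2 := by
    intro b m hb hb2 hm hbm
    have hwb := walk_even_mul hξ hBR hw1 hb2
    split_ifs with hmp
    · rw [walk_mul_add hξ hBR hm hbm (by omega), hwb]
      split_ifs <;> omega
    · rw [walk_mul_add_of_half hξ hBR hm hbm hb2 hb (by omega), hwb]
      split_ifs <;> omega
  have hqpos : 0 < convDen ξ (2 * n + 2) := by omega
  have hall : ∀ m ≤ convDen ξ (2 * n + 3),
      0 ≤ walk (2 * ξ) m ∧ walk (2 * ξ) m ≤ peakVal ξ (2 * n + 3) := by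
    intro m hm
    have hmod := (Nat.mod_lt m hqpos).le
    have hm1 := hdm m (convDen ξ (2 * n + 2))
    obtain ⟨b, hb⟩ : ∃ b, b = m / convDen ξ (2 * n + 2) := ⟨_, rfl⟩
    obtain ⟨r, hr⟩ : ∃ r, r = m % convDen ξ (2 * n + 2) := ⟨_, rfl⟩
    rw [← hb, ← hr] at hm1
    rw [← hr] at hmod
    have hba : b ≤ partQuot ξ (2 * n + 2) := by
      by_contra! hba
      have : (partQuot ξ (2 * n + 2) + 1) * convDen ξ (2 * n + 2) ≤ b * convDen ξ (2 * n + 2) :=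
        Nat.mul_le_mul_right _ hba
      rw [add_mul] at this
      omega
    obtain ⟨hr0, hr1⟩ := hbd r hmod
    rw [← hm1] at hm ⊢
    rw [hval]
    by_cases hb2 : 2 * b ≤ partQuot ξ (2 * n + 2)
    · rw [hfirst b r hb2 hmod hm]
      push_cast
      omega
    · rw [hsecond b r (by omega) hba hmod hm]
      -- A block of the second half may start at level a_{2n+3}/2 + 1, but before the reversed step
      -- W(r) is strictly below the maximum, which saves the upper bound.
      have := hless r
      split_ifs with hrp
      · have := this hrp
        push_cast; omega
      · push_cast; omega
  constructor <;> simp only [show 2 * (n + 1) = 2 * n + 2 by ring, add_assoc, Nat.reduceAdd]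
  · exact fun m hm => (hall m hm).1
  · exact fun m hm => (hall m hm).2
  -- The last, incomplete block has b = a_{2n+3} and m = q_{2n+1}, so the value is 2 + 0 - 2.
  · have := hsecond (partQuot ξ (2 * n + 2)) (convDen ξ (2 * n + 1)) (by omega) le_rfl hlt.le
      hq3.ge
    rw [← hq3, h.walk_odd, if_neg (by omega)] at this
    rw [this]; ring
  · exact hw1
  · intro b hb
    have hle : b * convDen ξ (2 * n + 2) ≤ halfQuot ξ (2 * n + 2) * convDen ξ (2 * n + 2) :=
      Nat.mul_le_mul_right _ hb
    have := hfirst b (peakPos ξ (2 * n + 2)) (by omega) (by omega) (by omega)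
    exact this.trans (by rw [hpeak])
  · intro b hb m hm
    have hle : b * convDen ξ (2 * n + 2) ≤ halfQuot ξ (2 * n + 2) * convDen ξ (2 * n + 2) :=
      Nat.mul_le_mul_right _ hb
    have hm1 := hdm m (convDen ξ (2 * n + 2))
    have hmod := Nat.mod_lt m hqpos
    obtain ⟨c, hc⟩ : ∃ c, c = m / convDen ξ (2 * n + 2) := ⟨_, rfl⟩
    obtain ⟨r, hr⟩ : ∃ r, r = m % convDen ξ (2 * n + 2) := ⟨_, rfl⟩
    rw [← hc, ← hr] at hm1
    rw [← hr] at hmod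
    have hcb : c ≤ b := by
      by_contra! hcb
      have : (b + 1) * convDen ξ (2 * n + 2) ≤ c * convDen ξ (2 * n + 2) :=
        Nat.mul_le_mul_right _ hcb
      rw [add_mul] at this
      omega
    have hmq : c * convDen ξ (2 * n + 2) + r ≤ convDen ξ (2 * n + 3) := by
      omega
    rw [← hm1, hfirst c r (by omega) hmod.le hmq]
    rcases hcb.lt_or_eq with hlt' | rfl
    · have := (hbd r hmod.le).2
      omega
    · have := hless r (by omega)
      omega

theorem walkBlock {ξ : ℝ} (hξ : Irrational ξ) (hBR : IsBRNumber ξ) (n : ℕ) : WalkBlock ξ n := by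
  induction n with
  | zero => exact walkBlock_zero hξ hBR
  | succ n ih => exact ih.succ hξ hBR

/-! ### The records -/

theorem walk_nonneg {ξ : ℝ} (hξ : Irrational ξ) (hBR : IsBRNumber ξ) (m : ℕ) :
    0 ≤ walk (2 * ξ) m :=
  (walkBlock hξ hBR m).nonneg m (le_trans (by omega) (le_convDen hξ (2 * m + 1)))

theorem monotone_peakVal (ξ : ℝ) : Monotone (peakVal ξ) :=
  monotone_nat_of_le_succ fun n => by rw [peakVal_succ]; omega

theorem IsBRNumber.halfQuot_pos {ξ : ℝ} (hBR : IsBRNumber ξ) (hξ : Irrational ξ) (n : ℕ) :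
    0 < halfQuot ξ (2 * n) := by
  have := hBR.two_mul_halfQuot hξ n
  have := one_le_partQuot hξ (2 * n)
  omega

/-- Every natural number lies in one of the intervals between the values `peakVal ξ (2 * n)`. -/
theorem IsBRNumber.exists_eq_add_peakVal {ξ : ℝ} (hBR : IsBRNumber ξ) (hξ : Irrational ξ) (v : ℕ) :
    ∃ n b, b < halfQuot ξ (2 * n) ∧ v = b + peakVal ξ (2 * n) := by
  induction v with
  | zero => exact ⟨0, 0, hBR.halfQuot_pos hξ 0, rfl⟩
  | succ v ih =>
    obtain ⟨n, b, hb, rfl⟩ := ih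
    rcases Nat.lt_or_ge (b + 1) (halfQuot ξ (2 * n)) with h | h
    · exact ⟨n, b + 1, h, by ring⟩
    · refine ⟨n + 1, 0, hBR.halfQuot_pos hξ (n + 1), ?_⟩
      rw [show 2 * (n + 1) = 2 * n + 2 by ring, peakVal_add_two, peakVal_succ]
      omega

/-- The first time at which the walk takes the value `v`. -/
def IsFirstTime (ξ : ℝ) (v r : ℕ) : Prop :=
  walk (2 * ξ) r = v ∧ ∀ m < r, walk (2 * ξ) m < v

theorem IsFirstTime.unique {ξ : ℝ} {v r s : ℕ} (hr : IsFirstTime ξ v r) (hs : IsFirstTime ξ v s) :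
    r = s := by
  rcases lt_trichotomy r s with h | h | h
  · exact absurd hr.1 (hs.2 r h).ne
  · exact h
  · exact absurd hs.1 (hr.2 s h).ne

theorem isFirstTime_add_peakVal {ξ : ℝ} (hξ : Irrational ξ) (hBR : IsBRNumber ξ) {n b : ℕ}
    (hb : b ≤ halfQuot ξ (2 * n)) :
    IsFirstTime ξ (b + peakVal ξ (2 * n)) (b * convDen ξ (2 * n) + peakPos ξ (2 * n)) := by
  have h := walkBlock hξ hBR n
  refine ⟨?_, fun m hm => ?_⟩
  · push_cast; exact h.walk_eq b hb
  · push_cast; exact h.walk_lt b hb m hm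

theorem exists_isFirstTime {ξ : ℝ} (hξ : Irrational ξ) (hBR : IsBRNumber ξ) (v : ℕ) :
    ∃ r, IsFirstTime ξ v r := by
  obtain ⟨n, b, hb, rfl⟩ := hBR.exists_eq_add_peakVal hξ v
  exact ⟨_, isFirstTime_add_peakVal hξ hBR hb.le⟩

/-- Since W is nonnegative and reaches every v ≥ 0 with only smaller values before, a new value is
always a new maximum. -/
theorem isRecord_iff_exists_isFirstTime {ξ : ℝ} (hξ : Irrational ξ) (hBR : IsBRNumber ξ) {r : ℕ} :
    IsRecord (2 * ξ) r ↔ ∃ v, IsFirstTime ξ v r := by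
  constructor
  · intro h
    obtain ⟨v, hv⟩ := Int.eq_ofNat_of_zero_le (walk_nonneg hξ hBR r)
    obtain ⟨s, hs⟩ := exists_isFirstTime hξ hBR v
    rcases lt_trichotomy r s with hlt | rfl | hlt
    · exact absurd hv (hs.2 r hlt).ne
    · exact ⟨v, hs⟩
    · exact absurd (hs.1.trans hv.symm) (h s hlt)
  · rintro ⟨v, h1, h2⟩ m hm h3
    exact (h2 m hm).ne (h3.trans h1)

/-- The records of `S_n(2ξ)` are the numbers `b q_{2n} + ∑_{i<n} (a_{2i+1} / 2) q_{2i}` with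
`0 ≤ b ≤ a_{2n+1} / 2`. -/
theorem isRecord_iff {ξ : ℝ} (hξ : Irrational ξ) (hBR : IsBRNumber ξ) {r : ℕ} :
    IsRecord (2 * ξ) r ↔
      ∃ n b, b ≤ halfQuot ξ (2 * n) ∧ r = b * convDen ξ (2 * n) + peakPos ξ (2 * n) := by
  rw [isRecord_iff_exists_isFirstTime hξ hBR]
  constructor
  · rintro ⟨v, hv⟩
    obtain ⟨n, b, hb, rfl⟩ := hBR.exists_eq_add_peakVal hξ v
    exact ⟨n, b, hb.le, hv.unique (isFirstTime_add_peakVal hξ hBR hb.le)⟩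
  · rintro ⟨n, b, hb, rfl⟩
    exact ⟨_, isFirstTime_add_peakVal hξ hBR hb⟩

/-- The time of the `v`-th record. -/
def recordTime (ξ : ℝ) (v : ℕ) : ℕ := sInf {r | walk (2 * ξ) r = v}

theorem recordTime_eq {ξ : ℝ} {v r : ℕ} (h : IsFirstTime ξ v r) : recordTime ξ v = r :=
  le_antisymm (Nat.sInf_le h.1) (not_lt.1 fun hlt =>
    (h.2 _ hlt).ne (Nat.sInf_mem (s := {r | walk (2 * ξ) r = v}) ⟨r, h.1⟩))

theorem isFirstTime_recordTime {ξ : ℝ} (hξ : Irrational ξ) (hBR : IsBRNumber ξ) (v : ℕ) :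
    IsFirstTime ξ v (recordTime ξ v) := by
  obtain ⟨r, hr⟩ := exists_isFirstTime hξ hBR v
  rwa [recordTime_eq hr]

theorem strictMono_recordTime {ξ : ℝ} (hξ : Irrational ξ) (hBR : IsBRNumber ξ) :
    StrictMono (recordTime ξ) := by
  refine strictMono_nat_of_lt_succ fun v => ?_
  have h1 := isFirstTime_recordTime hξ hBR v
  have h2 := isFirstTime_recordTime hξ hBR (v + 1)
  rcases lt_trichotomy (recordTime ξ v) (recordTime ξ (v + 1)) with h | h | h
  · exact h
  · have := h1.1.symm.trans (h ▸ h2.1)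
    push_cast at this; omega
  · have := h1.2 _ h
    rw [h2.1] at this
    push_cast at this; omega

theorem range_recordTime {ξ : ℝ} (hξ : Irrational ξ) (hBR : IsBRNumber ξ) :
    Set.range (recordTime ξ) = {r | IsRecord (2 * ξ) r} := by
  ext r
  rw [Set.mem_range, Set.mem_ofPred_eq, isRecord_iff_exists_isFirstTime hξ hBR]
  constructor
  · rintro ⟨v, rfl⟩
    exact ⟨v, isFirstTime_recordTime hξ hBR v⟩
  · rintro ⟨v, hv⟩
    exact ⟨v, recordTime_eq hv⟩

/-- The gaps between consecutive records are denominators of convergents of even index. -/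
theorem recordTime_succ {ξ : ℝ} (hξ : Irrational ξ) (hBR : IsBRNumber ξ) {n b : ℕ}
    (hb : b < halfQuot ξ (2 * n)) :
    recordTime ξ (b + peakVal ξ (2 * n) + 1) =
      recordTime ξ (b + peakVal ξ (2 * n)) + convDen ξ (2 * n) := by
  rw [recordTime_eq (isFirstTime_add_peakVal hξ hBR hb.le), add_right_comm,
    recordTime_eq (isFirstTime_add_peakVal hξ hBR (Nat.succ_le_of_lt hb)), Nat.succ_mul]
  ring

/-! ### Uniqueness of Ostrowski representations -/

/-- A maximal top digit forces the digit below it to vanish by condition (c); otherwise an unused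
copy of the top denominator absorbs the lower digits. -/
theorem IsOstrowski.sum_lt {ξ : ℝ} (hξ : Irrational ξ) {d : ℕ → ℕ} (hd : IsOstrowski ξ d) (n : ℕ) :
    ∑ i ∈ Finset.range n, d i * convDen ξ i < convDen ξ n := by
  obtain ⟨h0, h1, hrec⟩ := convDen_recursion hξ
  induction n using Nat.twoStepInduction with
  | zero => simp [h0]
  | one => simpa [h0, h1] using hd.zero_lt
  | more n ih1 ih2 =>
    rw [Finset.sum_range_succ, hrec]
    have hle := hd.le (n + 1) (by omega)
    rcases hle.lt_or_eq with h | h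
    · have : (d (n + 1) + 1) * convDen ξ (n + 1) ≤ partQuot ξ (n + 1) * convDen ξ (n + 1) :=
        Nat.mul_le_mul_right _ h
      rw [add_mul] at this
      omega
    · have h3 := hd.eq_zero (n + 1) (by omega) h
      rw [Nat.add_sub_cancel] at h3
      rw [Finset.sum_range_succ, h3, h]
      omega

/-- By `IsOstrowski.sum_lt` the top digit is the quotient of the sum by its denominator. -/
theorem IsOstrowski.eq_of_sum_eq {ξ : ℝ} (hξ : Irrational ξ) {d d' : ℕ → ℕ}
    (hd : IsOstrowski ξ d) (hd' : IsOstrowski ξ d') {n : ℕ}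
    (h : ∑ i ∈ Finset.range n, d i * convDen ξ i = ∑ i ∈ Finset.range n, d' i * convDen ξ i) :
    ∀ i < n, d i = d' i := by
  induction n with
  | zero => simp
  | succ n ih =>
    rw [Finset.sum_range_succ, Finset.sum_range_succ] at h
    have h1 := hd.sum_lt hξ n
    have h2 := hd'.sum_lt hξ n
    have hn : d n = d' n := by
      have e1 : d n = (∑ i ∈ Finset.range n, d i * convDen ξ i + d n * convDen ξ n) / convDen ξ n := by
        rw [Nat.add_mul_div_right _ _ (convDen_pos hξ n), Nat.div_eq_of_lt h1, zero_add]
      rw [e1, h, Nat.add_mul_div_right _ _ (convDen_pos hξ n), Nat.div_eq_of_lt h2, zero_add]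
    intro i hi
    rcases Nat.lt_succ_iff_lt_or_eq.1 hi with hlt | rfl
    · rw [hn] at h
      exact ih (Nat.add_right_cancel h) i hlt
    · exact hn

/-! ### Truncations of a digit sequence -/

/-- The sequence `d` follows `g` up to an index at which it may be smaller, and vanishes
thereafter. -/
def IsTruncation (g d : ℕ → ℕ) : Prop :=
  ∃ n, (∀ i < n, d i = g i) ∧ d n ≤ g n ∧ ∀ i, n < i → d i = 0

theorem IsTruncation.le {g d : ℕ → ℕ} (h : IsTruncation g d) (i : ℕ) : d i ≤ g i := by
  obtain ⟨n, h1, h2, h3⟩ := h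
  rcases lt_trichotomy i n with hi | rfl | hi
  · exact (h1 i hi).le
  · exact h2
  · rw [h3 i hi]; exact Nat.zero_le _

theorem halfQuot_lt {ξ : ℝ} (hξ : Irrational ξ) (i : ℕ) : halfQuot ξ i < partQuot ξ i := by
  have := one_le_partQuot hξ i
  unfold halfQuot
  split_ifs <;> omega

theorem IsTruncation.isOstrowski {ξ : ℝ} (hξ : Irrational ξ) {d : ℕ → ℕ}
    (h : IsTruncation (halfQuot ξ) d) : IsOstrowski ξ d := by
  have hlt := fun i => (h.le i).trans_lt (halfQuot_lt hξ i)
  exact ⟨hlt 0, fun i _ => (hlt i).le, fun i _ hi => absurd hi (hlt i).ne⟩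

theorem sum_range_eq_of_eq_zero {f : ℕ → ℕ} {m n : ℕ} (hm : ∀ i, m ≤ i → f i = 0)
    (hmn : m ≤ n) : ∑ i ∈ Finset.range n, f i = ∑ i ∈ Finset.range m, f i :=
  (Finset.sum_subset (Finset.range_mono hmn) fun i _ hi => hm i (by simpa using hi)).symm

/-- The records are the numbers with Ostrowski digits `a_1/2, 0, a_3/2, 0, …, b, 0, 0, …`. -/
theorem isRecord_sum_iff_isTruncation {ξ : ℝ} (hξ : Irrational ξ) (hBR : IsBRNumber ξ)
    {d : ℕ → ℕ} {N : ℕ} (hN : ∀ i, N ≤ i → d i = 0) :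
    IsOstrowski ξ d ∧ IsRecord (2 * ξ) (∑ i ∈ Finset.range N, d i * convDen ξ i) ↔
      IsTruncation (halfQuot ξ) d := by
  rw [isRecord_iff hξ hBR]
  constructor
  · rintro ⟨hd, n, b, hb, hsum⟩
    set d' : ℕ → ℕ := fun i => if i < 2 * n then halfQuot ξ i else if i = 2 * n then b else 0 with hd'
    have htr : IsTruncation (halfQuot ξ) d' := by
      refine ⟨2 * n, fun i hi => if_pos hi, ?_, fun i hi => ?_⟩
      · simpa [hd'] using hb
      · simp only [hd']; rw [if_neg (by omega), if_neg (by omega)]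
    have hz : ∀ i, 2 * n + 1 ≤ i → d' i = 0 := fun i hi => by
      simp only [hd']; rw [if_neg (by omega), if_neg (by omega)]
    have hsum' : ∑ i ∈ Finset.range (2 * n + 1), d' i * convDen ξ i =
        b * convDen ξ (2 * n) + peakPos ξ (2 * n) := by
      rw [Finset.sum_range_succ, add_comm]
      congr 1
      · simp [hd']
      · refine Finset.sum_congr rfl fun i hi => ?_
        simp only [hd']
        rw [if_pos (Finset.mem_range.1 hi)]
    have key : d = d' := by
      funext i
      -- The length exceeds both supports and the index i, so padding by zeros makes the sums
      -- comparable.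
      refine hd.eq_of_sum_eq hξ (htr.isOstrowski hξ) (n := N + (2 * n + 1) + i + 1) ?_ i (by omega)
      rw [sum_range_eq_of_eq_zero (m := N) (f := fun i => d i * convDen ξ i)
          (fun i hi => by rw [hN i hi, zero_mul]) (by omega),
        sum_range_eq_of_eq_zero (m := 2 * n + 1) (f := fun i => d' i * convDen ξ i)
          (fun i hi => by rw [hz i hi, zero_mul]) (by omega),
        hsum, hsum']
    rw [key]; exact htr
  · intro h
    refine ⟨h.isOstrowski hξ, ?_⟩
    obtain ⟨n, h1, h2, h3⟩ := h
    have hsum : ∑ i ∈ Finset.range N, d i * convDen ξ i =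
        d n * convDen ξ n + peakPos ξ n := by
      rw [← sum_range_eq_of_eq_zero (n := N + (n + 1)) (fun i hi => by rw [hN i hi, zero_mul])
        (by omega), sum_range_eq_of_eq_zero (m := n + 1)
        (fun i hi => by rw [h3 i (by omega), zero_mul]) (by omega), Finset.sum_range_succ, add_comm]
      congr 1
      exact Finset.sum_congr rfl fun i hi => by rw [h1 i (Finset.mem_range.1 hi)]
    obtain ⟨m, rfl | rfl⟩ := Nat.even_or_odd' n
    · exact ⟨m, d (2 * m), h2, hsum⟩
    -- A truncation at an odd index has digit 0 there, hence is also one at the next even index with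
    -- b = 0.
    · rw [halfQuot_odd] at h2
      refine ⟨m + 1, 0, Nat.zero_le _, ?_⟩
      rw [hsum, Nat.le_zero.1 h2, show 2 * (m + 1) = 2 * m + 2 by ring, peakPos_add_two]
      simp

/-! ### Automata -/

/-- The index where `d` leaves `g` lies either in the tail `y` or already in the head `x`; in the
latter case the tail is zero. -/
theorem isTruncation_append_iff {g d x y : ℕ → ℕ} {l : ℕ} (hl : ∀ i < l, d i = x i)
    (hr : ∀ i, d (l + i) = y i) (hx : ∀ i, l ≤ i → x i = 0) :
    IsTruncation g d ↔ ((∀ i < l, x i = g i) ∧ IsTruncation (fun i => g (l + i)) y) ∨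
      (IsTruncation g x ∧ ∀ i, y i = 0) := by
  constructor
  · rintro ⟨n, h1, h2, h3⟩
    rcases Nat.lt_or_ge n l with hn | hn
    · refine Or.inr ⟨⟨n, fun i hi => ?_, hl n hn ▸ h2, fun i hi => ?_⟩, fun i => ?_⟩
      · rw [← h1 i hi, hl i (by omega)]
      · rcases Nat.lt_or_ge i l with h | h
        · rw [← hl i h]; exact h3 i hi
        · exact hx i h
      · rw [← hr]; exact h3 (l + i) (by omega)
    · obtain ⟨k, rfl⟩ := Nat.exists_eq_add_of_le hn
      refine Or.inl ⟨fun i hi => ?_, k, fun i hi => ?_, hr k ▸ h2, fun i hi => ?_⟩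
      · rw [← hl i hi]; exact h1 i (by omega)
      · rw [← hr i]; exact h1 _ (by omega)
      · rw [← hr i]; exact h3 _ (by omega)
  · rintro (⟨h, n, h1, h2, h3⟩ | ⟨h, hy⟩)
    · refine ⟨l + n, fun i hi => ?_, (hr n).symm ▸ h2, fun i hi => ?_⟩
      · rcases Nat.lt_or_ge i l with hlt | hge
        · rw [hl i hlt]; exact h i hlt
        · obtain ⟨j, rfl⟩ := Nat.exists_eq_add_of_le hge
          rw [hr]; exact h1 j (by omega)
      · obtain ⟨j, rfl⟩ := Nat.exists_eq_add_of_le (show l ≤ i by omega)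
        rw [hr]; exact h3 j (by omega)
    · have hdx : d = x := by
        funext i
        rcases Nat.lt_or_ge i l with hlt | hge
        · exact hl i hlt
        · obtain ⟨j, rfl⟩ := Nat.exists_eq_add_of_le hge
          rw [hr, hy, hx _ hge]
      rw [hdx]; exact h

/-- The words whose digits are a truncation of `g`. -/
def truncationWords (B : ℕ) (g : ℕ → ℕ) : Language (Fin (B + 1)) :=
  {w | IsTruncation g (digit w)}

/-- The words whose digits are a truncation of a sequence with finitely many distinct shifts form
a regular language. -/
theorem isRegular_truncationWords (B : ℕ) {g : ℕ → ℕ}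
    (hg : (Set.range fun n i => g (n + i)).Finite) : (truncationWords B g).IsRegular := by
  -- Reversed words start with the least significant digit. By Myhill–Nerode it suffices that the
  -- left quotient by `x` depends only on the shift of `g` by the length of `x` and on two truth
  -- values: whether `x` agrees with `g`, and whether `x` is itself a truncation.
  apply Language.IsRegular.of_reverse
  apply Language.IsRegular.of_finite_range_leftQuotient
  let dig : List (Fin (B + 1)) → ℕ → ℕ := fun x i => (x.getD i 0 : Fin (B + 1))
  let Φ : (ℕ → ℕ) × Prop × Prop → Language (Fin (B + 1)) := fun s =>
    Set.ofPred fun y => (s.2.1 ∧ IsTruncation s.1 (dig y)) ∨ (s.2.2 ∧ ∀ i, dig y i = 0)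
  refine ((hg.prod (Set.finite_univ (α := Prop × Prop))).image Φ).subset ?_
  rintro _ ⟨x, rfl⟩
  refine ⟨(fun i => g (x.length + i), (∀ i < x.length, dig x i = g i),
    IsTruncation g (dig x)), ⟨⟨x.length, rfl⟩, trivial⟩, ?_⟩
  refine Language.ext fun y => ?_
  refine (isTruncation_append_iff (d := dig (x ++ y)) (fun i hi => ?_) (fun i => ?_)
    (fun i hi => ?_)).symm.trans ?_
  · simp only [dig]; rw [List.getD_append _ _ _ _ hi]
  · simp only [dig]; rw [List.getD_append_right _ _ _ _ (by omega), Nat.add_sub_cancel_left]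
  · simp only [dig]; rw [List.getD_eq_default _ _ hi]; rfl
  · change _ ↔ IsTruncation g (fun i => ((x ++ y).reverse.reverse.getD i 0 : Fin (B + 1)))
    rw [List.reverse_reverse]

/-- The sequence `g` is periodic with period `L` from the index `N` on. -/
def IsPeriodicFrom {α : Type*} (g : ℕ → α) (N L : ℕ) : Prop := ∀ i, N ≤ i → g (i + L) = g i

theorem IsPeriodicFrom.finite_range {α : Type*} {g : ℕ → α} {N L : ℕ} (h : IsPeriodicFrom g N L)
    (hL : 0 < L) : (Set.range g).Finite := by
  refine ((Finset.range (N + L)).finite_toSet.image g).subset ?_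
  rintro _ ⟨n, rfl⟩
  induction n using Nat.strong_induction_on with
  | _ n ih =>
    rcases Nat.lt_or_ge n (N + L) with hn | hn
    · exact ⟨n, by simpa using hn, rfl⟩
    · have := h (n - L) (by omega)
      rw [Nat.sub_add_cancel (by omega)] at this
      rw [this]
      exact ih _ (by omega)

theorem IsPeriodicFrom.shift {α : Type*} {g : ℕ → α} {N L : ℕ} (h : IsPeriodicFrom g N L) :
    IsPeriodicFrom (fun n i => g (n + i)) N L := by
  intro n hn
  funext i
  change g (n + L + i) = g (n + i)
  rw [add_right_comm]
  exact h _ (by omega)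

theorem IsPeriodicFrom.two_mul {α : Type*} {g : ℕ → α} {N L : ℕ} (h : IsPeriodicFrom g N L) :
    IsPeriodicFrom g N (2 * L) := by
  intro i hi
  rw [Nat.two_mul, ← add_assoc, h _ (by omega), h _ hi]

theorem IsPeriodicFrom.halfQuot {ξ : ℝ} {N L : ℕ} (h : IsPeriodicFrom (partQuot ξ) N L)
    (hL : Even L) : IsPeriodicFrom (halfQuot ξ) N L := by
  intro i hi
  simp only [OstrowskiWalk.halfQuot, h i hi, Nat.even_add, hL, iff_true]

theorem digit_eq_zero {B : ℕ} (w : List (Fin (B + 1))) {i : ℕ} (hi : w.length ≤ i) :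
    digit w i = 0 := by
  rw [digit, List.getD_eq_default _ _ (by simpa using hi)]
  rfl

theorem isOstrowskiAutomatic_isRecord {ξ : ℝ} (hξ : Irrational ξ) (hBR : IsBRNumber ξ) {N L : ℕ}
    (hL : 0 < L) (h : IsPeriodicFrom (partQuot ξ) N L) :
    IsOstrowskiAutomatic ξ {r | IsRecord (2 * ξ) r} := by
  obtain ⟨B, hB⟩ := (h.finite_range hL).bddAbove
  refine ⟨B, fun i => hB ⟨i, rfl⟩, ?_⟩
  -- The period is doubled to be even, since `halfQuot` depends on the parity of the index.
  have hfin := (h.two_mul.halfQuot (even_two_mul L)).shift.finite_range (by omega)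
  have heq : representations ξ B {r | IsRecord (2 * ξ) r} = truncationWords B (halfQuot ξ) :=
    Language.ext fun w => isRecord_sum_iff_isTruncation hξ hBR fun i hi => digit_eq_zero w hi
  rw [heq]
  exact isRegular_truncationWords B hfin

/-! ### Lagrange's theorem -/

/-- The determinant identity with the numerators eliminated; it gives q_{n+1}|q_nξ - p_n| ≤ 1, the
estimate behind Lagrange's theorem. -/
theorem convDen_mul_convErr_add {ξ : ℝ} (hξ : Irrational ξ) (n : ℕ) :
    convDen ξ (n + 1) * convErr ξ n + convDen ξ n * convErr ξ (n + 1) = 1 := by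
  have e1 := convDen_mul_sub_convNum hξ n
  have e2 := convDen_mul_sub_convNum hξ (n + 1)
  have h : (convDen ξ n : ℝ) * convNum ξ (n + 1) - convDen ξ (n + 1) * convNum ξ n = (-1) ^ n := by
    exact_mod_cast convDen_mul_convNum_sub hξ n
  have hs : ((-1 : ℝ) ^ n) * (-1) ^ n = 1 := by rw [← pow_add]; simp [← two_mul, pow_mul]
  rw [pow_succ] at e2
  linear_combination (-1 : ℝ) ^ n * (convDen ξ n * e2 - convDen ξ (n + 1) * e1 + h) +
    (1 - convDen ξ (n + 1) * convErr ξ n - convDen ξ n * convErr ξ (n + 1)) * hs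

theorem finite_setOf_quadratic_root (M : ℤ) :
    {x : ℝ | ∃ a b c : ℤ, a ≠ 0 ∧ |a| ≤ M ∧ |b| ≤ M ∧ |c| ≤ M ∧
      (a : ℝ) * x ^ 2 + b * x + c = 0}.Finite := by
  have hfin : ∀ s : ℤ × ℤ × ℤ,
      {x : ℝ | s.1 ≠ 0 ∧ (s.1 : ℝ) * x ^ 2 + s.2.1 * x + s.2.2 = 0}.Finite := by
    rintro ⟨a, b, c⟩
    by_cases ha : a = 0
    · simp [ha]
    · have ha' : (a : ℝ) ≠ 0 := by exact_mod_cast ha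
      refine ((Polynomial.C (a : ℝ) * Polynomial.X ^ 2 + Polynomial.C (b : ℝ) * Polynomial.X +
        Polynomial.C (c : ℝ)).roots.toFinset.finite_toSet).subset ?_
      rintro x ⟨-, hx⟩
      simp only [Finset.mem_coe, Multiset.mem_toFinset]
      rw [Polynomial.mem_roots (Polynomial.ne_zero_of_natDegree_gt
        (n := 1) (by rw [Polynomial.natDegree_quadratic ha']; norm_num))]
      simpa [Polynomial.IsRoot] using hx
  refine ((((Set.finite_Icc (-M) M).prod
    ((Set.finite_Icc (-M) M).prod (Set.finite_Icc (-M) M))).biUnion fun s _ => hfin s)).subset ?_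
  rintro x ⟨a, b, c, ha, h1, h2, h3, h⟩
  simp only [Set.mem_iUnion]
  exact ⟨(a, b, c), ⟨abs_le.1 h1, abs_le.1 h2, abs_le.1 h3⟩, ha, h⟩

/-- The complete quotients of a quadratic irrational are roots of quadratic polynomials with
bounded coefficients. -/
theorem exists_bound_completeQuot {ξ : ℝ} (h : IsQuadraticIrrational ξ) :
    ∃ M : ℤ, ∀ n, ∃ a b c : ℤ, a ≠ 0 ∧ |a| ≤ M ∧ |b| ≤ M ∧ |c| ≤ M ∧
      (a : ℝ) * completeQuot ξ (n + 2) ^ 2 + b * completeQuot ξ (n + 2) + c = 0 := by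
  obtain ⟨hξ, a, b, c, ha, hroot⟩ := h
  refine ⟨⌈2 * |2 * a * ξ + b| + 2 * |(a : ℝ)|⌉, fun n => ?_⟩
  have e1 := convDen_mul_sub_convNum hξ n
  have e2 := convDen_mul_sub_convNum hξ (n + 1)
  have hu := convErr_pos hξ n
  have hv := convErr_pos hξ (n + 1)
  have hu1 := convErr_lt_one hξ n
  have hv1 := convErr_lt_one hξ (n + 1)
  have hx := convErr_succ_mul hξ n
  have hx1 := one_lt_completeQuot_succ hξ (n + 1)
  have hsum := convDen_mul_convErr_add hξ n
  have hqq := convDen_le_succ hξ n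
  have hq := convDen_pos hξ (n + 1)
  have hvu : convErr ξ (n + 1) ≤ convErr ξ n := by nlinarith
  generalize convErr ξ n = u at *
  generalize convErr ξ (n + 1) = v at *
  generalize convDen ξ n = q' at *
  generalize convDen ξ (n + 1) = q at *
  generalize convNum ξ n = P' at *
  generalize convNum ξ (n + 1) = P at *
  rw [show n + 1 + 1 = n + 2 from rfl] at hx1
  generalize completeQuot ξ (n + 2) = x at *
  have hqr : (0 : ℝ) < q := by exact_mod_cast hq
  have hq'r : (0 : ℝ) ≤ q' := Nat.cast_nonneg _
  have hqqr : (q' : ℝ) ≤ q := by exact_mod_cast hqq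
  obtain ⟨s, hs⟩ : ∃ s : ℝ, s = (-1) ^ n := ⟨_, rfl⟩
  have hs1 : |s| = 1 := by rw [hs]; simp
  rw [pow_succ, ← hs] at e2
  rw [← hs] at e1
  have hP' : (P' : ℝ) = q' * ξ - s * u := by linarith
  have hP : (P : ℝ) = q * ξ - -(s * v) := by linarith
  have hqu : (q : ℝ) * u ≤ 1 := by nlinarith [mul_nonneg hq'r hv.le]
  have hqv : (q : ℝ) * v ≤ 1 := by nlinarith
  have hq'u : (q' : ℝ) * u ≤ 1 := by nlinarith
  have hq'v : (q' : ℝ) * v ≤ 1 := by nlinarith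
  -- the bound for the coefficients
  have bound : ∀ (X : ℤ) (m e : ℝ), (X : ℝ) = m * (2 * a * ξ + b) + e * a → |m| ≤ 2 → |e| ≤ 2 →
      |X| ≤ ⌈2 * |2 * a * ξ + b| + 2 * |(a : ℝ)|⌉ := by
    intro X m e hX hm he
    have : (|X| : ℝ) ≤ 2 * |2 * a * ξ + b| + 2 * |(a : ℝ)| := by
      rw [hX]
      refine (abs_add_le _ _).trans ?_
      rw [abs_mul, abs_mul]
      gcongr
    have := this.trans (Int.le_ceil _)
    exact_mod_cast this
  -- These coefficients come from substituting ξ = (Px + P')/(qx + q') in the equation of ξ.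
  -- Expanding around ξ removes the large terms, leaving denominators times errors.
  refine ⟨a * P ^ 2 + b * (P * q) + c * q ^ 2,
    2 * a * (P * P') + b * (P * q' + P' * q) + 2 * c * (q * q'),
    a * P' ^ 2 + b * (P' * q') + c * q' ^ 2, ?_, ?_, ?_, ?_, ?_⟩
  · intro hA
    have hAr : (a : ℝ) * P ^ 2 + b * (P * q) + c * q ^ 2 = 0 := by exact_mod_cast hA
    have h1 : (q * ξ - P : ℝ) * (a * q * ξ + a * P + b * q) = 0 := by
      linear_combination q ^ 2 * hroot - hAr
    have h2 : Irrational ((q : ℝ) * ξ - P) := (hξ.natCast_mul hq.ne').sub_intCast P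
    have h3 := (mul_eq_zero.1 h1).resolve_left h2.ne_zero
    have h4 : Irrational (((a * q : ℤ) : ℝ) * ξ + ((a * P + b * q : ℤ) : ℝ)) :=
      (hξ.intCast_mul (mul_ne_zero ha (by exact_mod_cast hq.ne'))).add_intCast _
    apply h4.ne_zero
    push_cast
    linear_combination h3
  · apply bound _ (q * (s * v)) (s ^ 2 * v ^ 2)
    · push_cast
      rw [hP]
      linear_combination q ^ 2 * hroot
    · rw [abs_mul, abs_mul, hs1, abs_of_pos hqr, abs_of_pos hv]; linarith
    · rw [abs_mul, abs_pow, hs1, abs_of_nonneg (by positivity)]; nlinarith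
  · apply bound _ (-(q * (s * u)) + q' * (s * v)) (-2 * (s ^ 2 * (u * v)))
    · push_cast
      rw [hP, hP']
      linear_combination 2 * q * q' * hroot
    · refine (abs_add_le _ _).trans ?_
      rw [abs_neg, abs_mul, abs_mul, abs_mul, abs_mul, hs1, abs_of_pos hqr, abs_of_pos hv,
        abs_of_pos hu, abs_of_nonneg hq'r]
      linarith
    · rw [abs_mul, abs_mul, abs_pow, hs1, abs_mul, abs_of_pos hu, abs_of_pos hv, abs_neg,
        abs_two]
      nlinarith
  · apply bound _ (-(q' * (s * u))) (s ^ 2 * u ^ 2)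
    · push_cast
      rw [hP']
      linear_combination q' ^ 2 * hroot
    · rw [abs_neg, abs_mul, abs_mul, hs1, abs_of_nonneg hq'r, abs_of_pos hu]; linarith
    · rw [abs_mul, abs_pow, hs1, abs_of_nonneg (by positivity)]; nlinarith
  · have hlin : (P * x + P' : ℝ) = (q * x + q') * ξ := by
      rw [hP, hP']; linear_combination s * hx
    push_cast
    linear_combination (q * x + q') ^ 2 * hroot +
      (a * (P * x + P' + (q * x + q') * ξ) + b * (q * x + q')) * hlin

/-- **Lagrange's theorem**: the continued fraction of a quadratic irrational is eventually
periodic. -/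
theorem IsQuadraticIrrational.exists_isPeriodicFrom {ξ : ℝ} (h : IsQuadraticIrrational ξ) :
    ∃ N L, 0 < L ∧ IsPeriodicFrom (partQuot ξ) N L := by
  have hξ := h.1
  obtain ⟨M, hM⟩ := exists_bound_completeQuot h
  have hfin : (Set.range fun n => completeQuot ξ (n + 2)).Finite :=
    (finite_setOf_quadratic_root M).subset (by rintro _ ⟨n, rfl⟩; exact hM n)
  obtain ⟨i, j, hij, heq⟩ : ∃ i j, i < j ∧ completeQuot ξ (i + 2) = completeQuot ξ (j + 2) := by
    by_contra! hne
    refine Set.infinite_range_of_injective (f := fun n => completeQuot ξ (n + 2)) ?_ hfin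
    intro i j hij
    rcases lt_trichotomy i j with hlt | rfl | hlt
    · exact absurd hij (hne i j hlt)
    · rfl
    · exact absurd hij.symm (hne j i hlt)
  have hall : ∀ k, completeQuot ξ (i + 2 + k) = completeQuot ξ (j + 2 + k) := by
    intro k
    induction k with
    | zero => exact heq
    | succ k ih => rw [← add_assoc, ← add_assoc, completeQuot, completeQuot, ih]
  refine ⟨i + 1, j - i, by omega, fun n hn => ?_⟩
  have h1 := partQuot_eq_floor hξ n
  have h2 := partQuot_eq_floor hξ (n + (j - i))
  have h3 := hall (n - (i + 1))
  rw [show i + 2 + (n - (i + 1)) = n + 1 by omega,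
    show j + 2 + (n - (i + 1)) = n + (j - i) + 1 by omega] at h3
  rw [← h3, ← h1] at h2
  exact_mod_cast h2

/-! ### Linear recurrences -/

/-- The terms of the solutions of a three-term recurrence depend linearly on the first two. -/
theorem exists_eq_linear_of_recurrence (a : ℕ → ℤ) (k : ℕ) :
    ∃ α β : ℤ, ∀ x : ℕ → ℤ, (∀ m, x (m + 2) = a m * x (m + 1) + x m) →
      x k = α * x 0 + β * x 1 := by
  induction k using Nat.twoStepInduction with
  | zero => exact ⟨1, 0, fun x _ => by ring⟩
  | one => exact ⟨0, 1, fun x _ => by ring⟩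
  | more k ih1 ih2 =>
    obtain ⟨α, β, h1⟩ := ih1
    obtain ⟨γ, δ, h2⟩ := ih2
    exact ⟨a k * γ + α, a k * δ + β, fun x hx => by rw [hx, h1 x hx, h2 x hx]; ring⟩

/-- A solution of a three-term recurrence with `L`-periodic coefficients satisfies a recurrence
with constant coefficients. -/
theorem exists_constant_recurrence {a x : ℕ → ℤ} {L : ℕ} (ha : ∀ m, a (m + L) = a m)
    (hx : ∀ m, x (m + 2) = a m * x (m + 1) + x m) :
    ∃ T D : ℤ, ∀ m, x (m + 2 * L) = T * x (m + L) - D * x m := by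
  obtain ⟨α, β, h1⟩ := exists_eq_linear_of_recurrence a L
  obtain ⟨γ, δ, h2⟩ := exists_eq_linear_of_recurrence a (L + 1)
  have hxL : ∀ m, x (m + 2 + L) = a m * x (m + 1 + L) + x (m + L) := fun m => by
    rw [← ha m, ← add_right_comm m L 1, ← hx, add_right_comm]
  have hx2L : ∀ m, x (m + 2 + 2 * L) = a m * x (m + 1 + 2 * L) + x (m + 2 * L) := fun m => by
    have := hxL (m + L)
    rw [ha] at this
    convert this using 2 <;> ring_nf
  have e1 := h1 x hx
  have e2 := h2 x hx
  have e3 := h1 (fun m => x (m + L)) hxL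
  have e4 := h2 (fun m => x (m + L)) hxL
  simp only [zero_add, add_right_comm _ 1 L, ← Nat.two_mul] at e3 e4
  -- Trace and determinant of the transfer matrix over L steps. Cayley–Hamilton gives m = 0 and m =
  -- 1; both sides obey the same three-term recurrence by periodicity.
  refine ⟨α + δ, α * δ - β * γ, fun m => ?_⟩
  induction m using Nat.twoStepInduction with
  | zero =>
    simp only [zero_add]
    rw [e3]
    linear_combination β * e2 - δ * e1
  | one =>
    simp only [add_comm 1]
    rw [e4]
    linear_combination γ * e1 - α * e2
  | more m ih1 ih2 =>
    rw [hx2L, hxL, hx, ih1, ih2]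
    ring

theorem IsPeriodicFrom.exists_convDen_recurrence {ξ : ℝ} (hξ : Irrational ξ) {N L : ℕ}
    (h : IsPeriodicFrom (partQuot ξ) N L) :
    ∃ T D : ℤ, ∀ m, N ≤ m →
      (convDen ξ (m + 2 * L) : ℤ) = T * convDen ξ (m + L) - D * convDen ξ m := by
  obtain ⟨-, -, hrec⟩ := convDen_recursion hξ
  obtain ⟨T, D, hTD⟩ := exists_constant_recurrence
    (a := fun m => (partQuot ξ (N + m + 1) : ℤ)) (x := fun m => (convDen ξ (N + m) : ℤ)) (L := L)
    (fun m => by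
      have := h (N + m + 1) (by omega)
      rw [show N + (m + L) + 1 = N + m + 1 + L by ring, this])
    (fun m => by
      rw [← add_assoc, hrec]; push_cast; rw [add_assoc])
  refine ⟨T, D, fun m hm => ?_⟩
  obtain ⟨k, rfl⟩ := Nat.exists_eq_add_of_le hm
  simpa only [add_assoc] using hTD k

theorem peakVal_add_period {ξ : ℝ} {N L : ℕ}
    (h : IsPeriodicFrom (halfQuot ξ) N L) {m : ℕ} (hm : N ≤ m) :
    peakVal ξ (m + L) + peakVal ξ N = peakVal ξ m + peakVal ξ (N + L) := by
  induction m, hm using Nat.le_induction with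
  | base => ring
  | succ m hm ih =>
    rw [add_right_comm, peakVal_succ, peakVal_succ, h m hm]
    omega

/-- A sequence whose increments satisfy a recurrence of order two in steps of `p` satisfies a
linear recurrence. -/
theorem satisfiesLinearRecurrenceSystem_of_increments {t : ℕ → ℤ} {V p : ℕ} {T D : ℤ} (hp : 0 < p)
    (h : ∀ v, V ≤ v → t (v + 2 * p + 1) - t (v + 2 * p) =
      T * (t (v + p + 1) - t (v + p)) - D * (t (v + 1) - t v)) :
    SatisfiesLinearRecurrenceSystem t := by
  -- One residue class suffices, and the order is large enough to skip all v < V. The coefficients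
  -- are added because their positions coincide in part when p = 1.
  refine ⟨1, V + 2 * p + 1, fun _ k => (if (k : ℕ) = 0 then 1 else 0) +
    (if (k : ℕ) = p - 1 then T else 0) + (if (k : ℕ) = p then -T else 0) +
    (if (k : ℕ) = 2 * p - 1 then -D else 0) + (if (k : ℕ) = 2 * p then D else 0), fun _ => 0,
    le_rfl, fun m r hm => ?_⟩
  simp only [Fin.val_eq_zero, one_mul, add_zero] at hm ⊢
  obtain ⟨v, rfl⟩ : ∃ v, m = v + 2 * p + 1 := ⟨m - (2 * p + 1), by omega⟩
  rw [Fin.sum_univ_eq_sum_range (fun k => ((if k = 0 then 1 else 0) +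
    (if k = p - 1 then T else 0) + (if k = p then -T else 0) +
    (if k = 2 * p - 1 then -D else 0) + (if k = 2 * p then D else 0)) *
      t (v + 2 * p + 1 - (k + 1)))]
  simp only [add_mul, ite_mul, zero_mul, Finset.sum_add_distrib, Finset.sum_ite_eq',
    Finset.mem_range]
  rw [if_pos (by omega), if_pos (by omega), if_pos (by omega), if_pos (by omega), if_pos (by omega),
    show v + 2 * p + 1 - (0 + 1) = v + 2 * p by omega,
    show v + 2 * p + 1 - (p - 1 + 1) = v + p + 1 by omega,
    show v + 2 * p + 1 - (p + 1) = v + p by omega,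
    show v + 2 * p + 1 - (2 * p - 1 + 1) = v + 1 by omega,
    show v + 2 * p + 1 - (2 * p + 1) = v by omega]
  linear_combination h v (by omega)

/-- Over one even period of the digits the number of records is constant, so shifting the record
number by it keeps b and shifts the gap q_{2n} by a full period of indices, where the denominators
satisfy an order-two recurrence. -/
theorem satisfiesLinearRecurrenceSystem_recordTime {ξ : ℝ} (hξ : Irrational ξ)
    (hBR : IsBRNumber ξ) {N L : ℕ} (hL : 0 < L) (h : IsPeriodicFrom (partQuot ξ) N L) :
    SatisfiesLinearRecurrenceSystem (fun v => (recordTime ξ v : ℤ)) := by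
  -- Start and period are made even, so that they match the even indices 2n of the gaps.
  have h2 : IsPeriodicFrom (partQuot ξ) (2 * N) (2 * L) := fun i hi => h.two_mul i (by omega)
  have hhalf := h2.halfQuot (even_two_mul L)
  obtain ⟨T, D, hTD⟩ := h2.exists_convDen_recurrence hξ
  have hpos : peakVal ξ (2 * N) < peakVal ξ (2 * N + 2 * L) := by
    have h1 := hBR.halfQuot_pos hξ N
    have h3 := monotone_peakVal ξ (show 2 * N + 1 ≤ 2 * N + 2 * L by omega)
    rw [peakVal_succ] at h3
    omega
  obtain ⟨p, hp⟩ := Nat.exists_eq_add_of_lt hpos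
  have hstep : ∀ n b, N ≤ n → b < halfQuot ξ (2 * n) → b < halfQuot ξ (2 * (n + L)) ∧
      b + peakVal ξ (2 * (n + L)) = b + peakVal ξ (2 * n) + (p + 1) := by
    intro n b hn hb
    have h3 := hhalf (2 * n) (by omega)
    have h4 := peakVal_add_period hhalf (m := 2 * n) (by omega)
    rw [mul_add]
    exact ⟨h3 ▸ hb, by omega⟩
  have hinc : ∀ n b, b < halfQuot ξ (2 * n) →
      (recordTime ξ (b + peakVal ξ (2 * n) + 1) : ℤ) - recordTime ξ (b + peakVal ξ (2 * n)) =
        convDen ξ (2 * n) := by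
    intro n b hb
    rw [recordTime_succ hξ hBR hb]
    push_cast; ring
  refine satisfiesLinearRecurrenceSystem_of_increments (V := peakVal ξ (2 * N)) (p := p + 1)
    (T := T) (D := D) (by omega) fun v hv => ?_
  obtain ⟨n, b, hb, rfl⟩ := hBR.exists_eq_add_peakVal hξ v
  have hn : N ≤ n := by
    by_contra! hlt
    have := monotone_peakVal ξ (show 2 * n + 1 ≤ 2 * N by omega)
    rw [peakVal_succ] at this
    omega
  obtain ⟨hb1, hv1⟩ := hstep n b hn hb
  obtain ⟨hb2, hv2⟩ := hstep (n + L) b (by omega) hb1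
  have i1 := hinc _ _ hb1
  have i2 := hinc _ _ hb2
  rw [hv1] at i1
  rw [hv2, hv1, add_assoc _ (p + 1) (p + 1), ← Nat.two_mul] at i2
  rw [i1, i2, hinc n b hb]
  have := hTD (2 * n) (by omega)
  convert this using 3 <;> ring_nf

end

end OstrowskiWalk

theorem mainTheorem5 (ξ : ℝ) (hquad : OstrowskiWalk.IsQuadraticIrrational ξ)
    (hBR : OstrowskiWalk.IsBRNumber ξ) :
    OstrowskiWalk.IsOstrowskiAutomatic ξ {r : ℕ | OstrowskiWalk.IsRecord (2 * ξ) r} ∧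
      ∃ t : ℕ → ℕ, StrictMono t ∧
        Set.range t = {r : ℕ | OstrowskiWalk.IsRecord (2 * ξ) r} ∧
        OstrowskiWalk.SatisfiesLinearRecurrenceSystem (fun n => (t n : ℤ)) := by
  obtain ⟨N, L, hL, h⟩ := hquad.exists_isPeriodicFrom
  have hξ := hquad.1
  exact ⟨OstrowskiWalk.isOstrowskiAutomatic_isRecord hξ hBR hL h, OstrowskiWalk.recordTime ξ,
    OstrowskiWalk.strictMono_recordTime hξ hBR, OstrowskiWalk.range_recordTime hξ hBR,
    OstrowskiWalk.satisfiesLinearRecurrenceSystem_recordTime hξ hBR hL h⟩
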